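/- **Definitions.** A *local algorithm* for strings $y\in\{0,1\}^N$ is randomized and possibly adaptive: on each input index it is a probability distribution over decision trees that read positions of $y$. It makes $q$ queries if on every input, every $y$ and every outcome of the randomness it reads at most $q$ positions. Let $C\colon\mathbb F_2^k\to\mathbb F_2^N$ and let $\Delta$ be the Hamming distance. - $C$ is a $(q,\delta,c,s)$-LDC if some $q$-query local algorithm $\mathrm{Dec}$ with outputs in $\{0,1\}$ satisfies, for all $b\in\mathbb F_2^k$ and $i\in[k]$: $\Pr[\mathrm{Dec}^{C(b)}(i)=b_i]\ge c$, and $\Pr[\mathrm{Dec}^{y}(i)\ne b_i]\le s$ for all $y$ with $\Delta(y,C(b))\le\delta N$. - $C$ is a $(q,\delta,c,s)$-RLDC if some $q$-query local algorithm with outputs in $\{0,1,\bot\}$ satisfies, for all $b,i$: $\Pr[\mathrm{Dec}^{C(b)}(i)=b_i]\ge c$, and $\Pr[\mathrm{Dec}^{y}(i)\notin\{b_i,\bot\}]\le s$ for all $y$ with $\Delta(y,C(b))\le\delta N$. - $C$ is a $(q,\delta,c,s)$-RLCC if the same holds for input indices $u\in[N]$ with $C(b)_u$ in place of $b_i$.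 For constants $\delta,\varepsilon,B,c,D>0$, call an injective linear map $C\colon\mathbb F_2^k\to\mathbb F_2^N$ *separating* if $N\le k^{B\log\log k}$ and $C$ is 1. a $(15,\delta,1,1/3)$-RLDC; 2. a $(41,\delta,1,1/2-\varepsilon)$-RLCC; 3. a $(58,\delta,1,1/3)$-RLCC; 4. not a $(q,\,D N^{-1/3},\,1,\,1/2-\eta)$-LDC for any integer $0\le q\le c\log k$ and any $\eta>0$. **The construction.** Let $n,d,t$ be natural numbers, $\mathbb F=\mathbb F_{2^t}$, and $m=\binom{n+d}{d}$. Choose an $\mathbb F_2$-basis of $\mathbb F$, with coordinate isomorphism $\pi\colon\mathbb F\to\mathbb F_2^t$; for every affine line $L\subset\mathbb F^n$ an ordered subset $S_L\subset L$ of $d+1$ points; and an $\mathbb F$-linear map $A$ from $\mathbb F^m$ to the polynomials of total degree at most $d$ in $n$ variables over $\mathbb F$ (Reed–Muller encoding) together with points $x^{(1)},\dots,x^{(m)}\in\mathbb F^n$ such that $(Aa)(x^{(i)})=a_i$ for all $a$ and $i$. The code maps a message $b\in(\mathbb F_2^t)^m$ to the polynomial $f=A(\pi^{-1}(b_1),\dots,\pi^{-1}(b_m))$,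 and then to the string indexed by all pairs $(L,v)$ of a line $L$ and $v\in(\mathbb F_2^{t})^{d+1}$ whose entry at $(L,v)$ is $\sum_{j=1}^{d+1}\langle v_j,\pi(f(S_L(j)))\rangle$ (the Hadamard encoding of $f$ on each line). Its message length is $k=tm$ and its blocklength is $N=\#\{\text{lines}\}\cdot 2^{t(d+1)}$. **Theorem.** (a) There are constants $\gamma,\delta,\varepsilon>0$ such that for all $a>0$ and $r\in\mathbb N$ there are constants $B,c,D>0$ with the following property. For all natural numbers $n\ge1$, $d$, $t$ with $an\le d\le\gamma n$ and $n\le 2^t\le n^r$, choices as in the construction exist, and for every such choice the code is separating with constants $\delta,\varepsilon,B,c,D$. (b) There are constants $\delta,\varepsilon,B,c,D>0$ such that for every $k\ge3$ there are $N$ and a linear map $C\colon\mathbb F_2^k\to\mathbb F_2^N$ that is separating with these constants. -/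

import Mathlib

/-- A deterministic (adaptive) query algorithm with oracle access to a string in `ι → α` and with
output in `β`: a decision tree whose inner nodes read one position and branch on the symbol read. -/
inductive DecisionTree (ι α β : Type) : Type
  | leaf (out : β) : DecisionTree ι α β
  | query (j : ι) (next : α → DecisionTree ι α β) : DecisionTree ι α β

namespace DecisionTree

variable {ι α β : Type}

/-- The output on the oracle string `y`. -/
def eval (y : ι → α) : DecisionTree ι α β → β
  | leaf out => out
  | query j next => (next (y j)).eval y

/-- The number of positions read on the oracle string `y`. -/
def numQueries (y : ι → α) : DecisionTree ι α β → ℕ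
  | leaf _ => 0
  | query j next => (next (y j)).numQueries y + 1

end DecisionTree

/-- A randomized local algorithm which takes an index in `κ` as input, has oracle access to a string
in `ι → α` and outputs an element of `β`: for every input, a distribution over decision trees. -/
def LocalAlgorithm (κ ι α β : Type) : Type := κ → PMF (DecisionTree ι α β)

namespace LocalAlgorithm

variable {κ ι α β : Type}

/-- On every input, every oracle string and every outcome of its randomness, the algorithm reads at
most `q` positions. -/
def QueriesAtMost (Dec : LocalAlgorithm κ ι α β) (q : ℕ) : Prop :=
  ∀ (i : κ), ∀ T ∈ (Dec i).support, ∀ y : ι → α, T.numQueries y ≤ q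

/-- `Pr[Dec^y(i) ∈ E]`. -/
noncomputable def prob (Dec : LocalAlgorithm κ ι α β) (y : ι → α) (i : κ) (E : Set β) : ℝ :=
  ((Dec i).toOuterMeasure {T | T.eval y ∈ E}).toReal

end LocalAlgorithm

section Codes

variable {κ ι α : Type} [Fintype ι] [DecidableEq α]

/-- `C` is a `(q, δ, c, s)`-locally decodable code. -/
def IsLDC (C : (κ → α) → (ι → α)) (q : ℕ) (δ c s : ℝ) : Prop :=
  ∃ Dec : LocalAlgorithm κ ι α α,
    Dec.QueriesAtMost q ∧
    (∀ (b : κ → α) (i : κ), c ≤ Dec.prob (C b) i {b i}) ∧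
    (∀ (b : κ → α) (i : κ) (y : ι → α),
      (hammingDist y (C b) : ℝ) ≤ δ * Fintype.card ι → Dec.prob y i {b i}ᶜ ≤ s)

/-- `C` is a `(q, δ, c, s)`-relaxed locally decodable code; the output `none` is the symbol `⊥`. -/
def IsRLDC (C : (κ → α) → (ι → α)) (q : ℕ) (δ c s : ℝ) : Prop :=
  ∃ Dec : LocalAlgorithm κ ι α (Option α),
    Dec.QueriesAtMost q ∧
    (∀ (b : κ → α) (i : κ), c ≤ Dec.prob (C b) i {some (b i)}) ∧
    (∀ (b : κ → α) (i : κ) (y : ι → α),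
      (hammingDist y (C b) : ℝ) ≤ δ * Fintype.card ι → Dec.prob y i {some (b i), none}ᶜ ≤ s)

/-- `C` is a `(q, δ, c, s)`-relaxed locally correctable code; the output `none` is the symbol `⊥`. -/
def IsRLCC (C : (κ → α) → (ι → α)) (q : ℕ) (δ c s : ℝ) : Prop :=
  ∃ Dec : LocalAlgorithm ι ι α (Option α),
    Dec.QueriesAtMost q ∧
    (∀ (b : κ → α) (u : ι), c ≤ Dec.prob (C b) u {some (C b u)}) ∧
    (∀ (b : κ → α) (u : ι) (y : ι → α),
      (hammingDist y (C b) : ℝ) ≤ δ * Fintype.card ι → Dec.prob y u {some (C b u), none}ᶜ ≤ s)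

end Codes

/-- The properties of a binary code with message length `k = |κ|` and blocklength `N = |ι|`:
it is a linear code (an injective linear map), `N ≤ k ^ (B log log k)`, it is a
`(15, δ, 1, 1/3)`-RLDC, a `(41, δ, 1, 1/2 - ε)`-RLCC and a `(58, δ, 1, 1/3)`-RLCC, and it is not a
`(q, D N^(-1/3), 1, 1/2 - η)`-LDC for any `q ≤ c log k` and any `η > 0`. -/
structure IsSeparatingCode {κ ι : Type} [Fintype κ] [Fintype ι]
    (C : (κ → ZMod 2) →ₗ[ZMod 2] (ι → ZMod 2)) (δ ε B c D : ℝ) : Prop where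
  injective : Function.Injective C
  blocklength_le : (Fintype.card ι : ℝ) ≤
    (Fintype.card κ : ℝ) ^ (B * Real.log (Real.log (Fintype.card κ)))
  isRLDC : IsRLDC C 15 δ 1 (1 / 3)
  isRLCC : IsRLCC C 41 δ 1 (1 / 2 - ε)
  isRLCC' : IsRLCC C 58 δ 1 (1 / 3)
  not_isLDC : ∀ q : ℕ, (q : ℝ) ≤ c * Real.log (Fintype.card κ) → ∀ η : ℝ, 0 < η →
    ¬ IsLDC C q (D * (Fintype.card ι : ℝ) ^ (-(1 / 3) : ℝ)) 1 (1 / 2 - η)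

section Construction

/-- The affine lines `{a + l b : l ∈ K}`, `b ≠ 0`, in `K ^ n`. -/
def Line (K : Type) [Field K] (n : ℕ) : Type :=
  {L : Set (Fin n → K) // ∃ a b : Fin n → K, b ≠ 0 ∧ L = Set.range fun l : K => a + l • b}

noncomputable instance (K : Type) [Field K] [Finite K] (n : ℕ) : Fintype (Line K n) :=
  have : Finite (Line K n) := Subtype.finite
  Fintype.ofFinite _

/-- The choices that enter the construction of the code from the polynomials of total degree at most
`d` in `n` variables over a field `K` with `2 ^ t` elements. -/
structure LineHadamardData (K : Type) [Field K] [Algebra (ZMod 2) K] (n d t : ℕ) where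
  /-- The basis of `K` over `𝔽₂` that defines the isomorphism `π : K ≃ 𝔽₂ ^ t`. -/
  basis : Module.Basis (Fin t) (ZMod 2) K
  /-- For every line `L`, an ordered subset `S_L` of `L` of size `d + 1`. -/
  pts : Line K n → Fin (d + 1) → (Fin n → K)
  pts_mem : ∀ L j, pts L j ∈ L.1
  pts_injective : ∀ L, Function.Injective (pts L)
  /-- The evaluation points that carry the message. -/
  msgPts : Fin ((n + d).choose d) → (Fin n → K)
  /-- The Reed-Muller encoding map. -/
  enc : (Fin ((n + d).choose d) → K) →ₗ[K] MvPolynomial.restrictTotalDegree (Fin n) K d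
  /-- The Reed-Muller encoding is systematic: the message is read off at the points `msgPts`. -/
  eval_enc : ∀ a i, MvPolynomial.eval (msgPts i) (enc a : MvPolynomial (Fin n) K) = a i

namespace LineHadamardData

variable {K : Type} [Field K] [Algebra (ZMod 2) K] {n d t : ℕ}

/-- The polynomial that encodes a message: the message is split into blocks of `t` bits, `π⁻¹` is
applied to every block, and the resulting vector over `K` is encoded by `enc`. -/
noncomputable def poly (P : LineHadamardData K n d t)
    (b : Fin ((n + d).choose d) × Fin t → ZMod 2) : MvPolynomial (Fin n) K :=
  (P.enc fun i => P.basis.equivFun.symm fun j => b (i, j) :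
    MvPolynomial.restrictTotalDegree (Fin n) K d)

theorem poly_add (P : LineHadamardData K n d t)
    (b b' : Fin ((n + d).choose d) × Fin t → ZMod 2) : P.poly (b + b') = P.poly b + P.poly b' := by
  unfold poly
  rw [← Submodule.coe_add, ← map_add]
  congr 2
  funext i
  rw [Pi.add_apply, ← map_add]
  rfl

/-- The code: the codeword of the polynomial `f` is the concatenation, over all lines `L`, of the
Hadamard encodings of `f(S_L)`. The bit at position `(L, v)` is `∑ j, ⟨v_j, π (f (S_L j))⟩`. -/
noncomputable def code (P : LineHadamardData K n d t) :
    (Fin ((n + d).choose d) × Fin t → ZMod 2) →ₗ[ZMod 2]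
      (Line K n × (Fin (d + 1) → Fin t → ZMod 2) → ZMod 2) :=
  AddMonoidHom.toZModLinearMap 2 <| AddMonoidHom.mk'
    (fun b u => ∑ j, u.2 j ⬝ᵥ P.basis.equivFun (MvPolynomial.eval (P.pts u.1 j) (P.poly b)))
    (by
      intro b b'
      funext u
      simp [poly_add, dotProduct_add, Finset.sum_add_distrib])

end LineHadamardData

end Construction

/-! All decoders accept only if certain parities vanish that vanish on every codeword, and then
output a parity. By linearity their error depends only on the error pattern `e`: a decoder is fooled
if `e` passes all checks and has odd output parity (`exists_relaxedDecoder`).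

Fix a line `L` and let `σ` be the mean of `(-1)^e` on its block. Two-query self-correction at any
position errs with probability at most `1 - |σ|` (`expect_selfCorrect_le`). By Lagrange
interpolation the bit `⟨w, π (f z)⟩` with `z ∈ L` sits at one Hadamard position `vec`. A nonzero
polynomial of degree at most `d` has few roots, so for random `z` and `w` these positions are nearly
unbiased against every nontrivial character. Fourier analysis then shows that self-correction at
such a random position is right with probability at most `(1 + σ² + d/|K|)/2`
(`expect_autocorrelation_le`). Hence a block on which self-correction is unreliable also betrays
itself at random points.

To decode at `x`, take a random line through `x` and compare it, at two random points, with random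
second lines. The second lines are almost uniform, so they are rarely misread. The error is about
`(1 - |σ|)((1 + σ²)/2)²`, below `1/3`, with 10 queries. To correct a position on a given line,
compare that line at three random points with the point decoder; AM-GM bounds the error by `1/3`,
with 38 queries. The query counts 15, 41 and 58 leave room.

For the lower bound, erase the blocks of all lines through the point `x` that carries a message bit.
Any `q ≤ d` other lines lie in the zero set of a polynomial of degree at most `d` that does not
vanish at `x`, a product of affine forms. Adding its message flips the bit without changing any
answer, so the decoder is wrong for half of all messages (`two_mul_card_wrong`,
`not_isLDC_of_shift`). The erased part has size at most `N^(2/3)`.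

For arbitrary `k`, the lengths available with `n = 100 d` grow by a bounded factor, so boundedly
many zero-padded copies suffice; the identity code serves the finitely many small `k`. -/

open scoped BigOperators

/-! ### Parity-checking decoders and their reduction to error patterns. -/

namespace DecisionTree

variable {ι β : Type}

/-- Read all positions of a list and continue with the sum of the answers. -/
def readSum : List ι → ZMod 2 → (ZMod 2 → DecisionTree ι (ZMod 2) β) → DecisionTree ι (ZMod 2) β
  | [], s, k => k s
  | j :: l, s, k => query j fun a => readSum l (s + a) k

theorem eval_readSum (y : ι → ZMod 2) (l : List ι) (s : ZMod 2)
    (k : ZMod 2 → DecisionTree ι (ZMod 2) β) :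
    (readSum l s k).eval y = (k (s + (l.map y).sum)).eval y := by
  induction l generalizing s with
  | nil => simp [readSum]
  | cons j l ih => simp [readSum, eval, ih, add_assoc]

theorem numQueries_readSum (y : ι → ZMod 2) (l : List ι) (s : ZMod 2)
    (k : ZMod 2 → DecisionTree ι (ZMod 2) β) :
    (readSum l s k).numQueries y = l.length + (k (s + (l.map y).sum)).numQueries y := by
  induction l generalizing s with
  | nil => simp [readSum]
  | cons j l ih => simp [readSum, numQueries, ih, add_assoc]; omega

/-- Output `⊥` unless all parities over the lists in `checks` vanish, and otherwise the parity over
`out`. -/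
def parityTree (out : List ι) : List (List ι) → DecisionTree ι (ZMod 2) (Option (ZMod 2))
  | [] => readSum out 0 fun s => leaf (some s)
  | l :: checks => readSum l 0 fun s => if s = 0 then parityTree out checks else leaf none

open Classical in
theorem eval_parityTree (y : ι → ZMod 2) (out : List ι) (checks : List (List ι)) :
    (parityTree out checks).eval y =
      if ∀ l ∈ checks, (l.map y).sum = 0 then some (out.map y).sum else none := by
  induction checks with
  | nil => simp [parityTree, eval_readSum, eval]
  | cons l checks ih =>
    simp only [parityTree, eval_readSum, zero_add, List.forall_mem_cons]
    by_cases h : (l.map y).sum = 0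
    · simp only [h, if_true, true_and, ih]
    · simp [h, eval]

theorem numQueries_parityTree_le (y : ι → ZMod 2) (out : List ι) (checks : List (List ι)) :
    (parityTree out checks).numQueries y ≤ (checks.map List.length).sum + out.length := by
  induction checks with
  | nil => simp [parityTree, numQueries_readSum, numQueries]
  | cons l checks ih =>
    simp only [parityTree, numQueries_readSum, zero_add, List.map_cons, List.sum_cons]
    split_ifs
    · omega
    · simp [numQueries]; omega

end DecisionTree

namespace LocalAlgorithm

variable {κ ι α β Ω : Type}

/-- The algorithm that runs the tree `T i ω` for a uniformly random `ω`. -/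
noncomputable def ofUniform [Fintype Ω] [Nonempty Ω] (T : κ → Ω → DecisionTree ι α β) :
    LocalAlgorithm κ ι α β :=
  fun i => (PMF.uniformOfFintype Ω).map (T i)

theorem queriesAtMost_ofUniform [Fintype Ω] [Nonempty Ω] {T : κ → Ω → DecisionTree ι α β} {q : ℕ}
    (h : ∀ i ω y, (T i ω).numQueries y ≤ q) : (ofUniform T).QueriesAtMost q := by
  intro i T' hT y
  simp only [ofUniform, PMF.support_map, Set.mem_image] at hT
  obtain ⟨ω, -, rfl⟩ := hT
  exact h i ω y

open Classical in
theorem prob_ofUniform [Fintype Ω] [Nonempty Ω] (T : κ → Ω → DecisionTree ι α β) (y : ι → α)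
    (i : κ) (E : Set β) :
    (ofUniform T).prob y i E = 𝔼 ω, if (T i ω).eval y ∈ E then (1 : ℝ) else 0 := by
  unfold prob ofUniform
  rw [PMF.toOuterMeasure_map_apply, PMF.toOuterMeasure_uniformOfFintype_apply,
    Fintype.expect_eq_sum_div_card, ENNReal.toReal_div, Finset.sum_boole]
  simp [Fintype.card_subtype]

end LocalAlgorithm

/-- On the error pattern `e`, all parities over `checks` vanish, but the parity over `out` does
not. -/
def Fooled {ι : Type} (e : ι → ZMod 2) (out : List ι) (checks : List (List ι)) : Prop :=
  (∀ l ∈ checks, (l.map e).sum = 0) ∧ (out.map e).sum ≠ 0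

open Classical in
/-- The indicator of `Fooled`. -/
noncomputable def fooledInd {ι : Type} (e : ι → ZMod 2) (out : List ι) (checks : List (List ι)) :
    ℝ := if Fooled e out checks then 1 else 0

theorem fooledInd_nonneg {ι : Type} (e : ι → ZMod 2) (out : List ι) (checks : List (List ι)) :
    0 ≤ fooledInd e out checks := by
  unfold fooledInd; split_ifs <;> norm_num

theorem fooledInd_of {ι : Type} {e : ι → ZMod 2} {out : List ι} {checks : List (List ι)}
    (h : Fooled e out checks) : fooledInd e out checks = 1 := if_pos h

theorem fooledInd_of_not {ι : Type} {e : ι → ZMod 2} {out : List ι} {checks : List (List ι)}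
    (h : ¬ Fooled e out checks) : fooledInd e out checks = 0 := if_neg h

section ParityDecoder

variable {κ ι Ω M : Type} [Fintype ι] [Fintype Ω] [Nonempty Ω]

-- Parities are additive and the checks vanish on `C b`, so on input `y` the run is governed by `y -
-- C b`: a wrong non-`⊥` output means exactly that this difference fools the decoder. Completeness
-- is perfect, since on a codeword every check passes.
open Classical in
theorem exists_relaxedDecoder (C : M → ι → ZMod 2) (target : κ → M → ZMod 2)
    (out : κ → Ω → List ι) (checks : κ → Ω → List (List ι)) {q : ℕ} {δ s : ℝ}
    (hq : ∀ i ω, ((checks i ω).map List.length).sum + (out i ω).length ≤ q)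
    (hchecks : ∀ b i ω, ∀ l ∈ checks i ω, (l.map (C b)).sum = 0)
    (hout : ∀ b i ω, ((out i ω).map (C b)).sum = target i b)
    (hs : ∀ e : ι → ZMod 2, (hammingNorm e : ℝ) ≤ δ * Fintype.card ι →
      ∀ i, 𝔼 ω, fooledInd e (out i ω) (checks i ω) ≤ s) :
    ∃ Dec : LocalAlgorithm κ ι (ZMod 2) (Option (ZMod 2)),
      Dec.QueriesAtMost q ∧
      (∀ b i, 1 ≤ Dec.prob (C b) i {some (target i b)}) ∧
      (∀ b i (y : ι → ZMod 2), (hammingDist y (C b) : ℝ) ≤ δ * Fintype.card ι →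
        Dec.prob y i {some (target i b), none}ᶜ ≤ s) := by
  refine ⟨.ofUniform fun i ω => .parityTree (out i ω) (checks i ω),
    LocalAlgorithm.queriesAtMost_ofUniform fun i ω y =>
      (DecisionTree.numQueries_parityTree_le y _ _).trans (hq i ω), fun b i => ?_,
    fun b i y hy => ?_⟩
  · rw [LocalAlgorithm.prob_ofUniform]
    simp only [DecisionTree.eval_parityTree, if_pos (hchecks b i _), hout, Set.mem_singleton_iff,
      if_true]
    simp
  · rw [LocalAlgorithm.prob_ofUniform]
    refine le_trans (Finset.expect_le_expect fun ω _ => ?_)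
      (hs (y - C b) (by rwa [hammingDist_comm, hammingDist_eq_hammingNorm, neg_add_eq_sub] at hy) i)
    have hsum : ∀ l : List ι, (l.map (y - C b)).sum = (l.map y).sum - (l.map (C b)).sum := by
      intro l
      induction l with
      | nil => simp
      | cons a l ih => simp only [List.map_cons, List.sum_cons, ih, Pi.sub_apply]; ring
    have hF : (DecisionTree.parityTree (out i ω) (checks i ω)).eval y ∈
        ({some (target i b), none} : Set (Option (ZMod 2)))ᶜ →
        Fooled (y - C b) (out i ω) (checks i ω) := by
      rw [DecisionTree.eval_parityTree]
      split_ifs with h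
      · intro h'
        refine ⟨fun l hl => by rw [hsum, h l hl, hchecks b i ω l hl, sub_zero], fun h0 => h' ?_⟩
        rw [hsum, hout, sub_eq_zero] at h0
        simp [h0]
      · simp
    split_ifs with h1
    · exact (fooledInd_of (hF h1)).ge
    · exact fooledInd_nonneg _ _ _

end ParityDecoder

/-! ### Signs, indicators and averages. -/

/-- The sign `(-1) ^ x` of a bit. -/
def bitSign (x : ZMod 2) : ℝ := if x = 0 then 1 else -1

theorem bitSign_add (x y : ZMod 2) : bitSign (x + y) = bitSign x * bitSign y := by
  have h : ∀ x : ZMod 2, x = 0 ∨ x = 1 := by decide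
  have h2 : (1 : ZMod 2) + 1 = 0 := by decide
  rcases h x with rfl | rfl <;> rcases h y with rfl | rfl <;> simp [bitSign, h2]

@[simp] theorem bitSign_zero : bitSign 0 = 1 := by simp [bitSign]

theorem bitSign_mul_self (x : ZMod 2) : bitSign x * bitSign x = 1 := by
  unfold bitSign; split_ifs <;> norm_num

theorem bitSign_le_one (x : ZMod 2) : bitSign x ≤ 1 := by
  unfold bitSign; split_ifs <;> norm_num

/-- The indicator that a bit is `0`. -/
def bitEven (x : ZMod 2) : ℝ := if x = 0 then 1 else 0

/-- The indicator that a bit is not `0`. -/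
def bitOdd (x : ZMod 2) : ℝ := if x ≠ 0 then 1 else 0

theorem bitEven_zero : bitEven 0 = 1 := if_pos rfl

theorem bitEven_of_ne {x : ZMod 2} (h : x ≠ 0) : bitEven x = 0 := if_neg h

theorem bitOdd_of_ne {x : ZMod 2} (h : x ≠ 0) : bitOdd x = 1 := if_pos h

theorem bitEven_nonneg (x : ZMod 2) : 0 ≤ bitEven x := by
  unfold bitEven; split_ifs <;> norm_num

theorem bitEven_le_one (x : ZMod 2) : bitEven x ≤ 1 := by
  unfold bitEven; split_ifs <;> norm_num

theorem bitOdd_nonneg (x : ZMod 2) : 0 ≤ bitOdd x := by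
  unfold bitOdd; split_ifs <;> norm_num

theorem bitOdd_le_one (x : ZMod 2) : bitOdd x ≤ 1 := by
  unfold bitOdd; split_ifs <;> norm_num

theorem bitEven_eq_bitSign (x : ZMod 2) : bitEven x = (1 + bitSign x) / 2 := by
  unfold bitEven bitSign; split_ifs <;> norm_num

theorem bitOdd_eq_bitSign (x : ZMod 2) : bitOdd x = (1 - bitSign x) / 2 := by
  unfold bitOdd bitSign; split_ifs <;> simp_all

theorem expect_prod_type {α β : Type} [Fintype α] [Fintype β] (f : α × β → ℝ) :
    𝔼 p, f p = 𝔼 a, 𝔼 b, f (a, b) := by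
  rw [← Finset.univ_product_univ, Finset.expect_product]

theorem expect_mul_prod_type {α β : Type} [Fintype α] [Fintype β] (f : α → ℝ) (g : β → ℝ) :
    𝔼 p : α × β, f p.1 * g p.2 = (𝔼 a, f a) * 𝔼 b, g b := by
  rw [expect_prod_type, Finset.expect_mul_expect]

theorem expect_prod_pi {α : Type} [Fintype α] (g : α → ℝ) (k : ℕ) :
    𝔼 p : Fin k → α, ∏ j, g (p j) = (𝔼 a, g a) ^ k := by
  classical
  rw [Finset.expect_pow, Fintype.piFinset_univ]

theorem expect_pi_apply {α : Type} [Fintype α] [Nonempty α] (g : α → ℝ) {k : ℕ} (j : Fin k) :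
    𝔼 p : Fin k → α, g (p j) = 𝔼 a, g a := by
  classical
  have h := Finset.prod_univ_sum (fun _ : Fin k => (Finset.univ : Finset α))
    (fun i a => if i = j then g a else 1)
  rw [Fintype.piFinset_univ] at h
  have h1 : ∀ p : Fin k → α, ∏ i, (if i = j then g (p i) else 1) = g (p j) := fun p => by
    rw [Finset.prod_eq_single j] <;> simp +contextual
  simp only [h1] at h
  rw [Fintype.expect_eq_sum_div_card, Fintype.expect_eq_sum_div_card, ← h,
    ← Finset.mul_prod_erase _ _ (Finset.mem_univ j)]
  have h2 : ∏ i ∈ Finset.univ.erase j, ∑ a : α, (if i = j then g a else 1) =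
      (Fintype.card α : ℝ) ^ (k - 1) := by
    rw [Finset.prod_congr rfl (g := fun _ => (Fintype.card α : ℝ))]
    · simp [Finset.card_erase_of_mem]
    · intro i hi
      simp [Finset.ne_of_mem_erase hi]
  have hk : k = k - 1 + 1 := by have := j.pos; omega
  have hα : (Fintype.card α : ℝ) ≠ 0 := by simp
  rw [h2, Fintype.card_pi]
  simp only [if_true, Finset.prod_const, Finset.card_univ, Fintype.card_fin, Nat.cast_pow]
  nth_rewrite 2 [hk]
  rw [pow_succ]
  field_simp

theorem expect_add_right {V : Type} [Fintype V] [AddCommGroup V] (f : V → ℝ) (u : V) :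
    𝔼 v, f (v + u) = 𝔼 v, f v :=
  Fintype.expect_equiv (Equiv.addRight u) _ _ fun _ => rfl

/-! ### Fourier analysis of error patterns on one Hadamard block. -/

section Fourier

variable {V : Type} [Fintype V] [AddCommGroup V]

/-- The probability that the two-query self-corrector errs is at most `1 - |σ|`, where `σ` is the
bias of the error pattern. -/
theorem expect_selfCorrect_le (e : V → ZMod 2) (u : V) :
    𝔼 r, (bitOdd (e r + e (r + u))) ≤ 1 - |𝔼 v, bitSign (e v)| := by
  -- An odd parity needs one of the two bits to be `1` and also one of them to be `0`. The two union
  -- bounds give `1 - σ` and `1 + σ`.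
  have h1 : ∀ r, (bitOdd (e r + e (r + u))) ≤
      (1 - bitSign (e r)) / 2 + (1 - bitSign (e (r + u))) / 2 := by
    intro r
    rw [bitOdd_eq_bitSign, bitSign_add]
    nlinarith [bitSign_le_one (e r), bitSign_le_one (e (r + u))]
  have h2 : ∀ r, (bitOdd (e r + e (r + u))) ≤
      (1 + bitSign (e r)) / 2 + (1 + bitSign (e (r + u))) / 2 := by
    intro r
    rw [bitOdd_eq_bitSign, bitSign_add]
    have h0 : ∀ x, -1 ≤ bitSign x := fun x => by unfold bitSign; split_ifs <;> norm_num
    nlinarith [h0 (e r), h0 (e (r + u))]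
  have h3 := Finset.expect_le_expect (s := Finset.univ) fun r _ => h1 r
  have h4 := Finset.expect_le_expect (s := Finset.univ) fun r _ => h2 r
  simp only [← Finset.expect_div, Finset.expect_add_distrib, Finset.expect_sub_distrib,
    Fintype.expect_const, expect_add_right (fun v => bitSign (e v))] at h3 h4
  rw [le_sub_comm]
  exact abs_le'.2 ⟨by linarith, by linarith⟩

/-- Translating by an `a` with `B a v = 1` negates the average and also preserves it. -/
theorem expect_bitSign_pairing (B : V →+ V →+ ZMod 2) (v : V) (hv : ∃ a, B a v ≠ 0) :
    𝔼 a, bitSign (B a v) = 0 := by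
  obtain ⟨a, ha⟩ := hv
  have h := expect_add_right (fun x => bitSign (B x v)) a
  simp only [map_add, AddMonoidHom.add_apply, bitSign_add] at h
  rw [← Finset.expect_mul] at h
  have : bitSign (B a v) = -1 := by simp [bitSign, ha]
  rw [this] at h
  linarith

/-- By nondegeneracy the `bitSign (B a ·)` serve as the characters of `V`, and this is the
Wiener–Khinchin formula: expand the squares and sum over `a` by orthogonality. The case `u = 0` is
Parseval. -/
theorem autocorrelation_eq (B : V →+ V →+ ZMod 2) (hB : ∀ v ≠ 0, ∃ a, B a v ≠ 0) (h : V → ℝ)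
    (u : V) :
    𝔼 r, h r * h (r + u) = ∑ a, (𝔼 r, h r * bitSign (B a r)) ^ 2 * bitSign (B a u) := by
  classical
  have hneg : ∀ x : ZMod 2, -x = x := by decide
  have hsq : ∀ a, (𝔼 r, h r * bitSign (B a r)) ^ 2 * bitSign (B a u) =
      𝔼 r, 𝔼 s, h r * h s * bitSign (B a (r + u - s)) := by
    intro a
    rw [sq, Fintype.expect_mul_expect, Finset.expect_mul]
    refine Finset.expect_congr rfl fun r _ => ?_
    rw [Finset.expect_mul]
    refine Finset.expect_congr rfl fun s _ => ?_
    rw [map_sub, map_add, sub_eq_add_neg, hneg, bitSign_add, bitSign_add]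
    ring
  have hV : (Fintype.card V : ℝ) ≠ 0 := by simp
  have hdelta : ∀ v, ∑ a, bitSign (B a v) = if v = 0 then (Fintype.card V : ℝ) else 0 := by
    intro v
    split_ifs with hv
    · simp [hv]
    · rw [← Fintype.card_mul_expect, expect_bitSign_pairing B v (hB v hv), mul_zero]
  simp only [hsq]
  rw [← Finset.expect_sum_comm]
  refine Finset.expect_congr rfl fun r _ => ?_
  rw [← Finset.expect_sum_comm]
  simp only [← Finset.mul_sum, hdelta, sub_eq_zero]
  simp only [mul_ite, mul_zero, Fintype.expect_ite_eq]
  rw [← NNRat.cast_smul_eq_nnqsmul ℝ]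
  simp only [NNRat.cast_inv, NNRat.cast_natCast, smul_eq_mul]
  field_simp

/-- The autocorrelation of a sign pattern, averaged over shifts `u i` which are nearly unbiased
against every nonzero vector. -/
theorem expect_autocorrelation_le {I : Type} [Fintype I] [Nonempty I] (B : V →+ V →+ ZMod 2)
    (hB : ∀ v ≠ 0, ∃ a, B a v ≠ 0) (e : V → ZMod 2) (u : I → V) {γ : ℝ} (hγ : 0 ≤ γ)
    (hu : ∀ a ≠ 0, 𝔼 i, bitSign (B a (u i)) ≤ γ) :
    𝔼 i, 𝔼 r, (bitEven (e r + e (r + u i))) ≤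
      (1 + (𝔼 v, bitSign (e v)) ^ 2 + γ) / 2 := by
  classical
  have h0 : ∀ i, 𝔼 r, (bitEven (e r + e (r + u i))) =
      (1 + 𝔼 r, bitSign (e r) * bitSign (e (r + u i))) / 2 := by
    intro i
    simp only [bitEven_eq_bitSign, bitSign_add, ← Finset.expect_div,
      Finset.expect_add_distrib, Fintype.expect_const]
  simp only [h0, ← Finset.expect_div, Finset.expect_add_distrib, Fintype.expect_const]
  have hpars := autocorrelation_eq B hB (fun v => bitSign (e v)) 0
  simp only [add_zero, bitSign_mul_self, Fintype.expect_const, map_zero, bitSign_zero,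
    mul_one] at hpars
  simp only [autocorrelation_eq B hB (fun v => bitSign (e v))]
  rw [Finset.expect_sum_comm]
  simp only [← Finset.mul_expect]
  -- The trivial character contributes `σ²`. All others are damped by `γ`, and the squared
  -- coefficients of a sign pattern sum to `1`.
  have : ∑ a, (𝔼 r, bitSign (e r) * bitSign (B a r)) ^ 2 * 𝔼 i, bitSign (B a (u i)) ≤
      ∑ a, ((if a = 0 then (𝔼 r, bitSign (e r) * bitSign (B a r)) ^ 2 else 0) +
        (𝔼 r, bitSign (e r) * bitSign (B a r)) ^ 2 * γ) := by
    refine Finset.sum_le_sum fun a _ => ?_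
    split_ifs with ha
    · subst ha
      simp only [map_zero, AddMonoidHom.zero_apply, bitSign_zero, mul_one, Fintype.expect_const]
      nlinarith [sq_nonneg (𝔼 r, bitSign (e r))]
    · rw [zero_add]
      exact mul_le_mul_of_nonneg_left (hu a ha) (sq_nonneg _)
  rw [Finset.sum_add_distrib, ← Finset.sum_mul, ← hpars] at this
  simp only [Finset.sum_ite_eq', Finset.mem_univ, if_true, map_zero, AddMonoidHom.zero_apply,
    bitSign_zero, mul_one] at this
  linarith

end Fourier

/-! ### Random lines and random points on them. -/

section Lines

variable {K : Type} [Field K] {n : ℕ}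

/-- The line through `a` in the direction `b`. -/
def Line.through (a : Fin n → K) (b : {b : Fin n → K // b ≠ 0}) : Line K n :=
  ⟨Set.range fun l : K => a + l • b.1, a, b.1, b.2, rfl⟩

theorem Line.exists_eq_through (L : Line K n) : ∃ a b, L = Line.through a b := by
  obtain ⟨L, a, b, hb, rfl⟩ := L
  exact ⟨a, ⟨b, hb⟩, rfl⟩

theorem Line.mem_through (a : Fin n → K) (b : {b : Fin n → K // b ≠ 0}) (l : K) :
    a + l • b.1 ∈ (Line.through a b).1 := ⟨l, rfl⟩

theorem Line.left_mem_through (a : Fin n → K) (b : {b : Fin n → K // b ≠ 0}) :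
    a ∈ (Line.through a b).1 := ⟨0, by simp⟩

theorem Line.injective_param (a : Fin n → K) (b : {b : Fin n → K // b ≠ 0}) :
    Function.Injective fun l : K => a + l • b.1 := by
  intro l l' h
  have h1 : l • b.1 = l' • b.1 := add_left_cancel h
  exact smul_left_injective K b.2 h1

/-- The parametrizations of a line. -/
theorem Line.through_eq_through_iff (a₀ a : Fin n → K) (b₀ b : {b : Fin n → K // b ≠ 0}) :
    Line.through a b = Line.through a₀ b₀ ↔
      ∃ l : K, ∃ m : Kˣ, a = a₀ + l • b₀.1 ∧ b.1 = (m : K) • b₀.1 := by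
  constructor
  · intro h
    have hset : (Line.through a b).1 = (Line.through a₀ b₀).1 := by rw [h]
    obtain ⟨l, hl⟩ : a ∈ (Line.through a₀ b₀).1 := hset ▸ Line.left_mem_through a b
    obtain ⟨l', hl'⟩ : a + (1 : K) • b.1 ∈ (Line.through a₀ b₀).1 := hset ▸ Line.mem_through a b 1
    have hb : b.1 = (l' - l) • b₀.1 := by
      have h1 : a₀ + l • b₀.1 = a := hl
      have h2 : a₀ + l' • b₀.1 = a + (1 : K) • b.1 := hl'
      rw [← h1, one_smul] at h2
      rw [sub_smul, eq_sub_iff_add_eq]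
      have := add_left_cancel (h2.trans (add_assoc _ _ _))
      rw [this, add_comm]
    have hne : l' - l ≠ 0 := fun h0 => b.2 (by rw [hb, h0, zero_smul])
    exact ⟨l, Units.mk0 _ hne, hl.symm, hb⟩
  · rintro ⟨l, m, rfl, hb⟩
    apply Subtype.ext
    ext z
    constructor
    · rintro ⟨c, rfl⟩
      exact ⟨l + c * m, by simp only [hb, add_smul, mul_smul, add_assoc]⟩
    · rintro ⟨c, rfl⟩
      refine ⟨(c - l) * (m⁻¹ : Kˣ), ?_⟩
      simp only [hb, smul_smul, add_assoc, ← add_smul]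
      congr 2
      rw [mul_assoc, Units.inv_mul, mul_one, add_sub_cancel]

variable [Fintype K] [DecidableEq K]

-- The base point moves along the line and the direction scales by a unit, independently. That the
-- fibres have constant size is what makes a random parametrization a uniform line.
open Classical in
theorem Line.card_fiber (L : Line K n) :
    (Finset.univ.filter fun p : (Fin n → K) × {b : Fin n → K // b ≠ 0} =>
      Line.through p.1 p.2 = L).card = Fintype.card (K × Kˣ) := by
  obtain ⟨a₀, b₀, rfl⟩ := L.exists_eq_through
  rw [← Finset.card_univ (α := K × Kˣ)]
  symm
  refine Finset.card_bij (fun q _ => (a₀ + q.1 • b₀.1, ⟨(q.2 : K) • b₀.1,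
    smul_ne_zero q.2.ne_zero b₀.2⟩)) ?_ ?_ ?_
  · intro q _
    simpa using (Line.through_eq_through_iff a₀ _ b₀ _).2 ⟨q.1, q.2, rfl, rfl⟩
  · rintro ⟨l, m⟩ _ ⟨l', m'⟩ _ h
    simp only [Prod.mk.injEq, Subtype.mk.injEq] at h
    refine Prod.ext (Line.injective_param a₀ b₀ h.1) (Units.ext ?_)
    exact smul_left_injective K b₀.2 h.2
  · rintro ⟨a, b⟩ h
    obtain ⟨l, m, h1, h2⟩ := (Line.through_eq_through_iff a₀ a b₀ b).1 (by simpa using h)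
    exact ⟨(l, m), Finset.mem_univ _, Prod.ext h1.symm (Subtype.ext h2.symm)⟩

open Classical in
theorem Line.sum_through (Φ : Line K n → ℝ) :
    ∑ p : (Fin n → K) × {b : Fin n → K // b ≠ 0}, Φ (Line.through p.1 p.2) =
      Fintype.card (K × Kˣ) * ∑ L, Φ L := by
  rw [← Finset.sum_fiberwise (s := Finset.univ) (g := fun p => Line.through p.1 p.2), Finset.mul_sum]
  refine Finset.sum_congr rfl fun L _ => ?_
  rw [Finset.sum_congr rfl (g := fun _ => Φ L) fun p hp => by rw [(Finset.mem_filter.1 hp).2],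
    Finset.sum_const, Line.card_fiber, nsmul_eq_mul]

theorem Line.card_mul_card :
    Fintype.card (K × Kˣ) * Fintype.card (Line K n) =
      Fintype.card ((Fin n → K) × {b : Fin n → K // b ≠ 0}) := by
  have h := Line.sum_through (K := K) (n := n) fun _ => 1
  simp only [Finset.sum_const, Finset.card_univ, nsmul_eq_mul, mul_one] at h
  exact_mod_cast h.symm

/-- The line through a uniformly random point in a uniformly random direction is uniformly
random. -/
theorem Line.expect_through (Φ : Line K n → ℝ) :
    𝔼 a : Fin n → K, 𝔼 b, Φ (Line.through a b) = 𝔼 L, Φ L := by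
  rw [← expect_prod_type (fun p => Φ (Line.through p.1 p.2)), Fintype.expect_eq_sum_div_card,
    Fintype.expect_eq_sum_div_card, Line.sum_through, ← Line.card_mul_card, Nat.cast_mul,
    mul_div_mul_left]
  simp

/-- On the line through a fixed point in a random direction, a random point is nearly uniform. -/
theorem Line.expect_point_le (x : Fin n → K) (G : (Fin n → K) → ℝ) (h0 : ∀ z, 0 ≤ G z)
    (h1 : ∀ z, G z ≤ 1) :
    𝔼 b : {b : Fin n → K // b ≠ 0}, 𝔼 l : K, G (x + l • b.1) ≤
      1 / Fintype.card K + 2 * 𝔼 z, G z := by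
  have hGnn : 0 ≤ 𝔼 z, G z := Finset.expect_nonneg fun z _ => h0 z
  have hK : (0 : ℝ) < Fintype.card K := by exact_mod_cast Fintype.card_pos
  rcases isEmpty_or_nonempty {b : Fin n → K // b ≠ 0} with hB | hB
  · rw [Finset.univ_eq_empty, Finset.expect_empty]
    positivity
  -- The parameter `l = 0` always gives `x` and costs `1 / |K|`. For `l ≠ 0` the point is uniform on
  -- the complement of `x`, and `|K|^n / (|K|^n - 1) ≤ 2`.
  have key : ∀ l : K, 𝔼 b : {b : Fin n → K // b ≠ 0}, G (x + l • b.1) ≤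
      (if l = 0 then 1 else 0) + 2 * 𝔼 z, G z := by
    intro l
    split_ifs with hl
    · have : 𝔼 b : {b : Fin n → K // b ≠ 0}, G (x + l • b.1) ≤ 1 :=
        Finset.expect_le Finset.univ_nonempty fun b _ => h1 _
      linarith
    · rw [zero_add, Fintype.expect_eq_sum_div_card, Fintype.expect_eq_sum_div_card]
      have hsum : ∑ b : {b : Fin n → K // b ≠ 0}, G (x + l • b.1) ≤ ∑ z, G z := by
        rw [← Finset.sum_image (s := Finset.univ) (f := G)
          (g := fun b : {b : Fin n → K // b ≠ 0} => x + l • b.1)]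
        · exact Finset.sum_le_sum_of_subset_of_nonneg (Finset.subset_univ _) fun z _ _ => h0 z
        · intro b _ b' _ h
          exact Subtype.ext (smul_right_injective _ hl (add_left_cancel h))
      have hcard : Fintype.card (Fin n → K) = Fintype.card {b : Fin n → K // b ≠ 0} + 1 := by
        rw [Fintype.card_subtype_compl, Fintype.card_subtype_eq]
        have : 0 < Fintype.card (Fin n → K) := Fintype.card_pos
        omega
      have hBpos : (1 : ℝ) ≤ Fintype.card {b : Fin n → K // b ≠ 0} := by
        exact_mod_cast Fintype.card_pos
      have hS : 0 ≤ ∑ z, G z := Finset.sum_nonneg fun z _ => h0 z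
      rw [hcard, Nat.cast_add, Nat.cast_one, mul_div_assoc', div_le_div_iff₀ (by linarith)
        (by linarith)]
      nlinarith
  rw [Finset.expect_comm]
  refine (Finset.expect_le_expect fun l _ => key l).trans ?_
  rw [Finset.expect_add_distrib, Fintype.expect_const]
  gcongr
  rw [Fintype.expect_eq_sum_div_card]
  simp

end Lines

/-! ### Lagrange interpolation and positions of point values in a block. -/

section Coefficients

variable {K : Type} [Field K] [Algebra (ZMod 2) K] {n d t : ℕ}

open Polynomial in
/-- Lagrange interpolation on a line. -/
theorem LineHadamardData.exists_coeffs (P : LineHadamardData K n d t) (L : Line K n) :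
    ∃ c : (Fin n → K) → Fin (d + 1) → K,
      (∀ f : MvPolynomial (Fin n) K, f.totalDegree ≤ d → ∀ z ∈ L.1,
        MvPolynomial.eval z f = ∑ j, c z j * MvPolynomial.eval (P.pts L j) f) ∧
      ∀ a b, L = Line.through a b → ∀ β : Fin (d + 1) → K, β ≠ 0 →
        ∃ s : Finset K, s.card ≤ d ∧ ∀ l, ∑ j, c (a + l • b.1) j * β j = 0 → l ∈ s := by
  classical
  obtain ⟨a₀, b₀, hL⟩ := L.exists_eq_through
  have hpts : ∀ j, ∃ l : K, a₀ + l • b₀.1 = P.pts L j := by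
    intro j
    have h := P.pts_mem L j
    rw [congrArg Subtype.val hL] at h
    exact h
  choose v hv using hpts
  have hvinj : Function.Injective v := fun i j h => P.pts_injective L (by rw [← hv, ← hv, h])
  -- The parameter of a point off the line is a dummy `0`.
  have hmem : ∀ z, ∃ l : K, z ∈ L.1 → a₀ + l • b₀.1 = z := by
    intro z
    by_cases hz : z ∈ L.1
    · rw [congrArg Subtype.val hL] at hz
      obtain ⟨l, hl⟩ := hz
      exact ⟨l, fun _ => hl⟩
    · exact ⟨0, fun h => absurd h hz⟩
  choose φ hφ using hmem
  have hinterp : ∀ (r : Fin (d + 1) → K) z, ∑ j, (Lagrange.basis Finset.univ v j).eval (φ z) * r j =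
      (Lagrange.interpolate Finset.univ v r).eval (φ z) := by
    intro r z
    rw [Lagrange.interpolate_apply, eval_finsetSum]
    exact Finset.sum_congr rfl fun j _ => by rw [eval_mul, eval_C, mul_comm]
  refine ⟨fun z j => (Lagrange.basis Finset.univ v j).eval (φ z), fun f hf z hz => ?_,
    fun a b hab β hβ => ?_⟩
  · set p : K[X] := MvPolynomial.aeval (fun i => C (a₀ i) + X * C (b₀.1 i)) f with hp
    have heval : ∀ l : K, p.eval l = MvPolynomial.eval (a₀ + l • b₀.1) f := by
      intro l
      rw [hp, ← coe_evalRingHom, MvPolynomial.aeval_def, MvPolynomial.hom_eval₂,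
        ← MvPolynomial.eval₂_id]
      congr 1
      · ext; simp
      · ext i; simp; ring
    have hdeg : p.degree < (Finset.univ : Finset (Fin (d + 1))).card := by
      refine lt_of_le_of_lt degree_le_natDegree ?_
      have : p.natDegree ≤ d * 1 := MvPolynomial.aeval_natDegree_le f hf _ fun i => by
        compute_degree
      rw [Finset.card_fin]
      exact_mod_cast Nat.lt_succ_of_le (by simpa using this)
    rw [hinterp, ← hφ z hz, ← heval]
    congr 1
    · rw [hφ z hz]
    · rw [Lagrange.eq_interpolate (fun i _ j _ h => hvinj h) hdeg]
      congr 1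
      funext j
      rw [heval, hv]
  -- As a function of the point, the combination with weights `β` is the interpolant of `β`, which
  -- is nonzero of degree at most `d`. Its roots refer to the parametrization `a₀, b₀` and are
  -- carried over to `a, b` as points of the line.
  · set q := Lagrange.interpolate Finset.univ v β with hq
    have hq0 : q ≠ 0 := by
      intro h0
      apply hβ
      funext j
      rw [← Lagrange.eval_interpolate_at_node β (fun i _ j _ h => hvinj h) (Finset.mem_univ j),
        ← hq, h0, eval_zero, Pi.zero_apply]
    have hqd : q.natDegree ≤ d := by
      have h := Lagrange.degree_interpolate_lt β
        (fun i _ j _ h => hvinj h : Set.InjOn v (Finset.univ : Finset (Fin (d + 1))))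
      rw [Finset.card_fin] at h
      exact Nat.lt_succ_iff.1 ((natDegree_lt_iff_degree_lt hq0).2 h)
    have hinj := Line.injective_param a b
    refine ⟨Finset.preimage (q.roots.toFinset.image fun l => a₀ + l • b₀.1)
      (fun l : K => a + l • b.1) hinj.injOn, ?_, fun l hl => ?_⟩
    · rw [← Finset.card_image_of_injective _ hinj, Finset.image_preimage]
      refine (Finset.card_filter_le _ _).trans ?_
      exact Finset.card_image_le.trans
        ((Multiset.toFinset_card_le _).trans ((card_roots' q).trans hqd))
    · rw [hinterp] at hl
      simp only [Finset.mem_preimage, Finset.mem_image, Multiset.mem_toFinset]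
      refine ⟨φ (a + l • b.1), (mem_roots hq0).2 hl, hφ _ ?_⟩
      rw [hab]
      exact Line.mem_through a b l

end Coefficients

/-- The pairing `⟨u, v⟩ = ∑ i, u i * v i` on bit vectors. -/
def dotPairing (ι : Type) [Fintype ι] : (ι → ZMod 2) →+ (ι → ZMod 2) →+ ZMod 2 :=
  AddMonoidHom.mk' (fun u => AddMonoidHom.mk' (fun v => u ⬝ᵥ v) fun v v' => dotProduct_add u v v')
    fun u u' => by ext v; simp

theorem dotPairing_apply {ι : Type} [Fintype ι] (u v : ι → ZMod 2) :
    dotPairing ι u v = u ⬝ᵥ v := rfl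

/-- The pairing `⟨u, v⟩ = ∑ j, ⟨u j, v j⟩` on block vectors. -/
def blockPairing (d t : ℕ) :
    (Fin (d + 1) → Fin t → ZMod 2) →+ (Fin (d + 1) → Fin t → ZMod 2) →+ ZMod 2 :=
  AddMonoidHom.mk' (fun u => AddMonoidHom.mk' (fun v => ∑ j, u j ⬝ᵥ v j)
      fun v v' => by simp [dotProduct_add, Finset.sum_add_distrib])
    fun u u' => by ext v; simp [add_dotProduct, Finset.sum_add_distrib]

theorem blockPairing_apply {d t : ℕ} (u v : Fin (d + 1) → Fin t → ZMod 2) :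
    blockPairing d t u v = ∑ j, u j ⬝ᵥ v j := rfl

theorem exists_dotPairing_ne_zero {ι : Type} [Fintype ι] (v : ι → ZMod 2) (hv : v ≠ 0) :
    ∃ u, dotPairing ι u v ≠ 0 := by
  classical
  obtain ⟨i, hi⟩ := Function.ne_iff.1 hv
  exact ⟨Pi.single i 1, by simpa [dotPairing_apply] using hi⟩

theorem exists_blockPairing_ne_zero {d t : ℕ} (v : Fin (d + 1) → Fin t → ZMod 2) (hv : v ≠ 0) :
    ∃ u, blockPairing d t u v ≠ 0 := by
  obtain ⟨j, hj⟩ := Function.ne_iff.1 hv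
  obtain ⟨u, hu⟩ := exists_dotPairing_ne_zero (v j) hj
  refine ⟨Pi.single j u, ?_⟩
  rw [blockPairing_apply, Finset.sum_eq_single j]
  · simpa [dotPairing_apply] using hu
  · intro i _ hi
    simp [Pi.single_eq_of_ne hi]
  · simp

namespace LineHadamardData

variable {K : Type} [Field K] [Algebra (ZMod 2) K] {n d t : ℕ}

/-- The Lagrange coefficients that recover the value at a point of `L` from the values at
`S_L`. -/
noncomputable def coeff (P : LineHadamardData K n d t) (L : Line K n) :
    (Fin n → K) → Fin (d + 1) → K := (P.exists_coeffs L).choose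

/-- The position in the block of `L` that carries the bit `⟨w, π (f z)⟩`, for `z ∈ L`. -/
noncomputable def vec (P : LineHadamardData K n d t) (L : Line K n) (z : Fin n → K)
    (w : Fin t → ZMod 2) : Fin (d + 1) → Fin t → ZMod 2 :=
  fun j i => w ⬝ᵥ P.basis.equivFun (P.coeff L z j * P.basis i)

/-- Multiplication by a Lagrange coefficient is `𝔽₂`-linear in the coordinates, and `vec` is the
image of `w` under the transposed maps. -/
theorem vec_pairing (P : LineHadamardData K n d t) (L : Line K n) (z : Fin n → K)
    (w : Fin t → ZMod 2) (α : Fin (d + 1) → Fin t → ZMod 2) :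
    ∑ j, P.vec L z w j ⬝ᵥ α j =
      w ⬝ᵥ P.basis.equivFun (∑ j, P.coeff L z j * P.basis.equivFun.symm (α j)) := by
  rw [map_sum, dotProduct_sum]
  refine Finset.sum_congr rfl fun j _ => ?_
  rw [Module.Basis.equivFun_symm_apply, Finset.mul_sum, map_sum, dotProduct_sum]
  refine Finset.sum_congr rfl fun i _ => ?_
  rw [mul_smul_comm, map_smul, dotProduct_smul, smul_eq_mul, mul_comm]
  rfl

theorem code_apply (P : LineHadamardData K n d t)
    (b : Fin ((n + d).choose d) × Fin t → ZMod 2)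
    (u : Line K n × (Fin (d + 1) → Fin t → ZMod 2)) :
    P.code b u =
      ∑ j, u.2 j ⬝ᵥ P.basis.equivFun (MvPolynomial.eval (P.pts u.1 j) (P.poly b)) := rfl

theorem code_add_right (P : LineHadamardData K n d t)
    (b : Fin ((n + d).choose d) × Fin t → ZMod 2) (L : Line K n)
    (u v : Fin (d + 1) → Fin t → ZMod 2) :
    P.code b (L, u + v) = P.code b (L, u) + P.code b (L, v) := by
  simp [code_apply, add_dotProduct, Finset.sum_add_distrib]

theorem totalDegree_poly_le (P : LineHadamardData K n d t)
    (b : Fin ((n + d).choose d) × Fin t → ZMod 2) : (P.poly b).totalDegree ≤ d :=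
  (MvPolynomial.mem_restrictTotalDegree _ _ _).1 (Subtype.property _)

theorem code_vec (P : LineHadamardData K n d t)
    (b : Fin ((n + d).choose d) × Fin t → ZMod 2) {L : Line K n} {z : Fin n → K} (hz : z ∈ L.1)
    (w : Fin t → ZMod 2) :
    P.code b (L, P.vec L z w) = w ⬝ᵥ P.basis.equivFun (MvPolynomial.eval z (P.poly b)) := by
  rw [code_apply, vec_pairing]
  simp only [LinearEquiv.symm_apply_apply]
  rw [(P.exists_coeffs L).choose_spec.1 _ (P.totalDegree_poly_le b) z hz]
  rfl

theorem eval_msgPts (P : LineHadamardData K n d t)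
    (b : Fin ((n + d).choose d) × Fin t → ZMod 2) (i : Fin ((n + d).choose d)) (j : Fin t) :
    P.basis.equivFun (MvPolynomial.eval (P.msgPts i) (P.poly b)) j = b (i, j) := by
  rw [poly, P.eval_enc, LinearEquiv.apply_symm_apply]

variable [Fintype K]

/-- At a fixed point the character of `α` becomes a character in `w`, with mean `0` unless the
interpolant of `α` vanishes there. That happens at no more than `d` of the `|K|` points. -/
theorem expect_bitSign_vec_le (P : LineHadamardData K n d t) {L : Line K n} {a : Fin n → K}
    {b : {b : Fin n → K // b ≠ 0}} (hL : L = Line.through a b)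
    {α : Fin (d + 1) → Fin t → ZMod 2} (hα : α ≠ 0) :
    𝔼 p : K × (Fin t → ZMod 2), bitSign (blockPairing d t α (P.vec L (a + p.1 • b.1) p.2)) ≤
      d / Fintype.card K := by
  classical
  obtain ⟨s, hs, hroots⟩ := (P.exists_coeffs L).choose_spec.2 a b hL
    (fun j => P.basis.equivFun.symm (α j)) (by
      obtain ⟨j, hj⟩ := Function.ne_iff.1 hα
      refine Function.ne_iff.2 ⟨j, ?_⟩
      exact fun h0 => hj (P.basis.equivFun.symm.map_eq_zero_iff.1 h0))
  have h1 : ∀ l : K, 𝔼 w, bitSign (blockPairing d t α (P.vec L (a + l • b.1) w)) ≤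
      if l ∈ s then 1 else 0 := by
    intro l
    split_ifs with hl
    · exact Finset.expect_le Finset.univ_nonempty fun _ _ => bitSign_le_one _
    · have h2 : ∀ w, blockPairing d t α (P.vec L (a + l • b.1) w) = dotPairing (Fin t) w
          (P.basis.equivFun (∑ j, P.coeff L (a + l • b.1) j * P.basis.equivFun.symm (α j))) := by
        intro w
        rw [dotPairing_apply, ← vec_pairing, blockPairing_apply]
        exact Finset.sum_congr rfl fun j _ => dotProduct_comm _ _
      simp only [h2]
      refine (expect_bitSign_pairing _ _ (exists_dotPairing_ne_zero _ fun h0 => hl ?_)).le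
      exact hroots l (P.basis.equivFun.map_eq_zero_iff.1 h0)
  rw [expect_prod_type]
  refine (Finset.expect_le_expect fun l _ => h1 l).trans ?_
  rw [Fintype.expect_eq_sum_div_card]
  gcongr
  simpa using hs

end LineHadamardData

/-! ### The tests, their randomness and their query counts. -/

/-- The two queries of the self-corrector of the block of `L` at the position `v`. -/
def selfCorrect {K : Type} [Field K] {n d t : ℕ} (L : Line K n)
    (v r : Fin (d + 1) → Fin t → ZMod 2) : List (Line K n × (Fin (d + 1) → Fin t → ZMod 2)) :=
  [(L, r), (L, r + v)]

theorem sum_map_selfCorrect {K : Type} [Field K] {n d t : ℕ}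
    (e : Line K n × (Fin (d + 1) → Fin t → ZMod 2) → ZMod 2) (L : Line K n)
    (v r : Fin (d + 1) → Fin t → ZMod 2) :
    ((selfCorrect L v r).map e).sum = e (L, r) + e (L, r + v) := by
  simp [selfCorrect]

theorem zmod_two_add_self (x : ZMod 2) : x + x = 0 := by revert x; decide

/-- The randomness of the test that compares a line with a second line that meets it. -/
abbrev TestRand (K : Type) [Field K] (n d t : ℕ) : Type :=
  K × (Fin t → ZMod 2) × (Fin (d + 1) → Fin t → ZMod 2) × {b : Fin n → K // b ≠ 0} ×
    (Fin (d + 1) → Fin t → ZMod 2)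

/-- The randomness of the decoder for the values at a point. -/
abbrev PointRand (K : Type) [Field K] (n d t : ℕ) : Type :=
  {b : Fin n → K // b ≠ 0} × (Fin (d + 1) → Fin t → ZMod 2) × (Fin 2 → TestRand K n d t)

/-- The randomness of the corrector for the positions of the codeword. -/
abbrev PositionRand (K : Type) [Field K] (n d t : ℕ) : Type :=
  (Fin (d + 1) → Fin t → ZMod 2) ×
    (Fin 3 → K × (Fin t → ZMod 2) × (Fin (d + 1) → Fin t → ZMod 2) × PointRand K n d t)

namespace LineHadamardData

variable {K : Type} [Field K] [Algebra (ZMod 2) K] {n d t : ℕ}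

/-- The comparison of the line through `x` in the direction `b` with a line that meets it. -/
noncomputable def lineTest (P : LineHadamardData K n d t) (x : Fin n → K)
    (b : {b : Fin n → K // b ≠ 0}) (τ : TestRand K n d t) :
    List (Line K n × (Fin (d + 1) → Fin t → ZMod 2)) :=
  selfCorrect (Line.through x b) (P.vec (Line.through x b) (x + τ.1 • b.1) τ.2.1) τ.2.2.1 ++
    selfCorrect (Line.through (x + τ.1 • b.1) τ.2.2.2.1)
      (P.vec (Line.through (x + τ.1 • b.1) τ.2.2.2.1) (x + τ.1 • b.1) τ.2.1) τ.2.2.2.2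

/-- The output parity of the decoder for `⟨w, π (f x)⟩`. -/
noncomputable def pointOut (P : LineHadamardData K n d t) (x : Fin n → K) (w : Fin t → ZMod 2)
    (ω : PointRand K n d t) : List (Line K n × (Fin (d + 1) → Fin t → ZMod 2)) :=
  selfCorrect (Line.through x ω.1) (P.vec (Line.through x ω.1) x w) ω.2.1

/-- The checks of the decoder for the values at `x`. -/
noncomputable def pointChecks (P : LineHadamardData K n d t) (x : Fin n → K)
    (ω : PointRand K n d t) : List (List (Line K n × (Fin (d + 1) → Fin t → ZMod 2))) :=
  List.ofFn fun j => P.lineTest x ω.1 (ω.2.2 j)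

/-- The checks of the corrector for the positions in the block of the line through `a` in the
direction `b`. -/
noncomputable def positionChecks (P : LineHadamardData K n d t) (a : Fin n → K)
    (b : {b : Fin n → K // b ≠ 0}) (ω : PositionRand K n d t) :
    List (List (Line K n × (Fin (d + 1) → Fin t → ZMod 2))) :=
  (List.ofFn fun j =>
    (selfCorrect (Line.through a b)
        (P.vec (Line.through a b) (a + (ω.2 j).1 • b.1) (ω.2 j).2.1) (ω.2 j).2.2.1 ++
      P.pointOut (a + (ω.2 j).1 • b.1) (ω.2 j).2.1 (ω.2 j).2.2.2) ::
    P.pointChecks (a + (ω.2 j).1 • b.1) (ω.2 j).2.2.2).flatten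

theorem sum_map_selfCorrect_code (P : LineHadamardData K n d t)
    (b : Fin ((n + d).choose d) × Fin t → ZMod 2) (L : Line K n)
    (v r : Fin (d + 1) → Fin t → ZMod 2) :
    ((selfCorrect L v r).map (P.code b)).sum = P.code b (L, v) := by
  rw [sum_map_selfCorrect, code_add_right, ← add_assoc, zmod_two_add_self, zero_add]

theorem sum_map_lineTest_code (P : LineHadamardData K n d t)
    (m : Fin ((n + d).choose d) × Fin t → ZMod 2) (x : Fin n → K)
    (b : {b : Fin n → K // b ≠ 0}) (τ : TestRand K n d t) :
    ((P.lineTest x b τ).map (P.code m)).sum = 0 := by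
  rw [lineTest, List.map_append, List.sum_append, sum_map_selfCorrect_code,
    sum_map_selfCorrect_code, code_vec _ _ (Line.mem_through _ _ _),
    code_vec _ _ (Line.left_mem_through _ _), zmod_two_add_self]

theorem sum_map_pointOut_code (P : LineHadamardData K n d t)
    (m : Fin ((n + d).choose d) × Fin t → ZMod 2) (x : Fin n → K) (w : Fin t → ZMod 2)
    (ω : PointRand K n d t) :
    ((P.pointOut x w ω).map (P.code m)).sum =
      w ⬝ᵥ P.basis.equivFun (MvPolynomial.eval x (P.poly m)) := by
  rw [pointOut, sum_map_selfCorrect_code, code_vec _ _ (Line.left_mem_through _ _)]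

theorem sum_map_pointChecks_code (P : LineHadamardData K n d t)
    (m : Fin ((n + d).choose d) × Fin t → ZMod 2) (x : Fin n → K) (ω : PointRand K n d t) :
    ∀ l ∈ P.pointChecks x ω, (l.map (P.code m)).sum = 0 := by
  rw [pointChecks, List.forall_mem_ofFn_iff]
  exact fun j => P.sum_map_lineTest_code _ _ _ _

theorem sum_map_positionChecks_code (P : LineHadamardData K n d t)
    (m : Fin ((n + d).choose d) × Fin t → ZMod 2) (a : Fin n → K)
    (b : {b : Fin n → K // b ≠ 0}) (ω : PositionRand K n d t) :
    ∀ l ∈ P.positionChecks a b ω, (l.map (P.code m)).sum = 0 := by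
  simp only [positionChecks, List.mem_flatten]
  rintro l ⟨l', hl', hl⟩
  obtain ⟨j, rfl⟩ := List.mem_ofFn.1 hl'
  rcases List.mem_cons.1 hl with rfl | hl
  · rw [List.map_append, List.sum_append, sum_map_selfCorrect_code, sum_map_pointOut_code,
      code_vec _ _ (Line.mem_through _ _ _), zmod_two_add_self]
  · exact P.sum_map_pointChecks_code _ _ _ _ hl

theorem length_pointChecks (P : LineHadamardData K n d t) (x : Fin n → K)
    (w : Fin t → ZMod 2) (ω : PointRand K n d t) :
    ((P.pointChecks x ω).map List.length).sum + (P.pointOut x w ω).length = 10 := by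
  simp [pointChecks, pointOut, lineTest, selfCorrect, List.ofFn_succ]

theorem length_positionChecks (P : LineHadamardData K n d t) (a : Fin n → K)
    (b : {b : Fin n → K // b ≠ 0}) (ω : PositionRand K n d t) :
    ((P.positionChecks a b ω).map List.length).sum = 36 := by
  simp [positionChecks, pointChecks, pointOut, lineTest, selfCorrect, List.ofFn_succ]

end LineHadamardData

/-! ### Soundness of the point decoder and of the position corrector. -/

set_option synthInstance.maxSize 1000

theorem expect_bitOdd {ι : Type} [Fintype ι] (e : ι → ZMod 2) :
    𝔼 i, (bitOdd (e i)) = hammingNorm e / Fintype.card ι := by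
  simp only [bitOdd]
  rw [Fintype.expect_eq_sum_div_card, Finset.sum_boole]
  rfl

theorem abs_expect_bitSign_le_one {V : Type} [Fintype V] (e : V → ZMod 2) :
    |𝔼 v, bitSign (e v)| ≤ 1 := by
  refine (Finset.abs_expect_le _ _).trans ?_
  rcases isEmpty_or_nonempty V with hV | hV
  · simp
  · refine Finset.expect_le Finset.univ_nonempty fun v _ => ?_
    unfold bitSign
    split_ifs <;> simp

/-- A single reading error on a random line that meets a random line through `x`. -/
theorem Line.expect_reading_error_le {K : Type} [Field K] [Fintype K] [DecidableEq K] {n d t : ℕ}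
    (e : Line K n × (Fin (d + 1) → Fin t → ZMod 2) → ZMod 2) {δ : ℝ}
    (he : (hammingNorm e : ℝ) ≤
      δ * Fintype.card (Line K n × (Fin (d + 1) → Fin t → ZMod 2)))
    (hδ : 0 ≤ δ) (x : Fin n → K) :
    𝔼 b : {b : Fin n → K // b ≠ 0}, 𝔼 l : K, 𝔼 b', 𝔼 r,
      (bitOdd (e (Line.through (x + l • b.1) b', r))) ≤
        1 / Fintype.card K + 2 * δ := by
  have h := Line.expect_point_le x
    (fun z => 𝔼 b', 𝔼 r, (bitOdd (e (Line.through z b', r))))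
    (fun z => Finset.expect_nonneg fun _ _ => Finset.expect_nonneg fun _ _ => bitOdd_nonneg _)
    (fun z => by
      rcases isEmpty_or_nonempty {b : Fin n → K // b ≠ 0} with hB | hB
      · rw [Finset.univ_eq_empty, Finset.expect_empty]
        exact zero_le_one
      · exact Finset.expect_le Finset.univ_nonempty fun _ _ =>
          Finset.expect_le Finset.univ_nonempty fun _ _ => bitOdd_le_one _)
  refine h.trans ?_
  rw [Line.expect_through fun L => 𝔼 r, (bitOdd (e (L, r))),
    ← expect_prod_type (fun u => bitOdd (e u)), expect_bitOdd]
  gcongr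
  exact div_le_of_le_mul₀ (Nat.cast_nonneg _) hδ he

namespace LineHadamardData

variable {K : Type} [Field K] [Algebra (ZMod 2) K] {n d t : ℕ}

/-- Union bound: either some read on a second line is corrupted, or each test reduces to an even
parity on the line through `x`. In the first product all factors concern that one line, so they are
independent once the line is fixed. -/
theorem ite_fooled_point_le (P : LineHadamardData K n d t)
    (e : Line K n × (Fin (d + 1) → Fin t → ZMod 2) → ZMod 2)
    (x : Fin n → K) (w : Fin t → ZMod 2) (ω : PointRand K n d t) :
    (fooledInd e (P.pointOut x w ω) (P.pointChecks x ω)) ≤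
      (bitOdd (((P.pointOut x w ω).map e).sum)) *
        ∏ j, (bitEven (e (Line.through x ω.1, (ω.2.2 j).2.2.1) +
            e (Line.through x ω.1, (ω.2.2 j).2.2.1 +
              P.vec (Line.through x ω.1) (x + (ω.2.2 j).1 • ω.1.1) (ω.2.2 j).2.1))) +
      ∑ j, ((bitOdd (e (Line.through (x + (ω.2.2 j).1 • ω.1.1) (ω.2.2 j).2.2.2.1,
            (ω.2.2 j).2.2.2.2))) +
          (bitOdd (e (Line.through (x + (ω.2.2 j).1 • ω.1.1) (ω.2.2 j).2.2.2.1,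
            (ω.2.2 j).2.2.2.2 + P.vec (Line.through (x + (ω.2.2 j).1 • ω.1.1) (ω.2.2 j).2.2.2.1)
              (x + (ω.2.2 j).1 • ω.1.1) (ω.2.2 j).2.1)))) := by
  have hnn : ∀ j ∈ (Finset.univ : Finset (Fin 2)),
      (0 : ℝ) ≤ ((bitOdd (e (Line.through (x + (ω.2.2 j).1 • ω.1.1) (ω.2.2 j).2.2.2.1,
            (ω.2.2 j).2.2.2.2))) +
          (bitOdd (e (Line.through (x + (ω.2.2 j).1 • ω.1.1) (ω.2.2 j).2.2.2.1,
            (ω.2.2 j).2.2.2.2 + P.vec (Line.through (x + (ω.2.2 j).1 • ω.1.1) (ω.2.2 j).2.2.2.1)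
              (x + (ω.2.2 j).1 • ω.1.1) (ω.2.2 j).2.1)))) := fun j _ =>
    add_nonneg (bitOdd_nonneg _) (bitOdd_nonneg _)
  by_cases hF : Fooled e (P.pointOut x w ω) (P.pointChecks x ω)
  swap
  · rw [fooledInd_of_not hF]
    exact add_nonneg (mul_nonneg (bitOdd_nonneg _) (Finset.prod_nonneg fun _ _ => bitEven_nonneg _))
      (Finset.sum_nonneg hnn)
  rw [fooledInd_of hF, bitOdd_of_ne hF.2, one_mul]
  by_cases hE : ∀ j, e (Line.through (x + (ω.2.2 j).1 • ω.1.1) (ω.2.2 j).2.2.2.1,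
            (ω.2.2 j).2.2.2.2) = 0 ∧
          e (Line.through (x + (ω.2.2 j).1 • ω.1.1) (ω.2.2 j).2.2.2.1,
            (ω.2.2 j).2.2.2.2 + P.vec (Line.through (x + (ω.2.2 j).1 • ω.1.1) (ω.2.2 j).2.2.2.1)
              (x + (ω.2.2 j).1 • ω.1.1) (ω.2.2 j).2.1) = 0
  · have h1 := hF.1
    rw [pointChecks, List.forall_mem_ofFn_iff] at h1
    refine le_add_of_le_of_nonneg ?_ (Finset.sum_nonneg hnn)
    rw [Finset.prod_eq_one]
    intro j _
    have h2 := h1 j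
    rw [lineTest, List.map_append, List.sum_append, sum_map_selfCorrect, sum_map_selfCorrect,
      (hE j).1, (hE j).2, add_zero, add_zero] at h2
    rw [h2, bitEven_zero]
  · push Not at hE
    obtain ⟨j, hj⟩ := hE
    refine le_add_of_nonneg_of_le (Finset.prod_nonneg fun _ _ => bitEven_nonneg _) ?_
    refine le_trans ?_ (Finset.single_le_sum hnn (Finset.mem_univ j))
    by_cases h0 : e (Line.through (x + (ω.2.2 j).1 • ω.1.1) (ω.2.2 j).2.2.2.1,
            (ω.2.2 j).2.2.2.2) = 0
    · rw [bitOdd_of_ne (hj h0)]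
      exact le_add_of_nonneg_left (bitOdd_nonneg _)
    · rw [bitOdd_of_ne h0]
      exact le_add_of_nonneg_right (bitOdd_nonneg _)

/-- If the given line errs at a comparison point, passing the comparison requires the point decoder
to err there as well while its own checks pass. Thus every round is either even on the line or fools
the point decoder. -/
theorem ite_fooled_position_le (P : LineHadamardData K n d t)
    (e : Line K n × (Fin (d + 1) → Fin t → ZMod 2) → ZMod 2)
    (a : Fin n → K) (b : {b : Fin n → K // b ≠ 0}) (v : Fin (d + 1) → Fin t → ZMod 2)
    (ω : PositionRand K n d t) :
    (fooledInd e (selfCorrect (Line.through a b) v ω.1) (P.positionChecks a b ω)) ≤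
      (bitOdd (e (Line.through a b, ω.1) + e (Line.through a b, ω.1 + v))) *
        ∏ j, ((bitEven (e (Line.through a b, (ω.2 j).2.2.1) +
            e (Line.through a b, (ω.2 j).2.2.1 +
              P.vec (Line.through a b) (a + (ω.2 j).1 • b.1) (ω.2 j).2.1))) + (1 - (bitEven (e (Line.through a b, (ω.2 j).2.2.1) +
            e (Line.through a b, (ω.2 j).2.2.1 +
              P.vec (Line.through a b) (a + (ω.2 j).1 • b.1) (ω.2 j).2.1)))) *
          (fooledInd e (P.pointOut (a + (ω.2 j).1 • b.1) (ω.2 j).2.1 (ω.2 j).2.2.2)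
            (P.pointChecks (a + (ω.2 j).1 • b.1) (ω.2 j).2.2.2))) := by
  have hprod : ∀ j, (0 : ℝ) ≤ ((bitEven (e (Line.through a b, (ω.2 j).2.2.1) +
            e (Line.through a b, (ω.2 j).2.2.1 +
              P.vec (Line.through a b) (a + (ω.2 j).1 • b.1) (ω.2 j).2.1))) + (1 - (bitEven (e (Line.through a b, (ω.2 j).2.2.1) +
            e (Line.through a b, (ω.2 j).2.2.1 +
              P.vec (Line.through a b) (a + (ω.2 j).1 • b.1) (ω.2 j).2.1)))) *
          (fooledInd e (P.pointOut (a + (ω.2 j).1 • b.1) (ω.2 j).2.1 (ω.2 j).2.2.2)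
            (P.pointChecks (a + (ω.2 j).1 • b.1) (ω.2 j).2.2.2))) := fun j =>
    add_nonneg (bitEven_nonneg _) (mul_nonneg (sub_nonneg.2 (bitEven_le_one _)) (fooledInd_nonneg _ _ _))
  by_cases hF : Fooled e (selfCorrect (Line.through a b) v ω.1) (P.positionChecks a b ω)
  swap
  · rw [fooledInd_of_not hF]
    exact mul_nonneg (bitOdd_nonneg _) (Finset.prod_nonneg fun j _ => hprod j)
  have hout := hF.2
  rw [sum_map_selfCorrect] at hout
  rw [fooledInd_of hF, bitOdd_of_ne hout, one_mul, Finset.prod_eq_one]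
  intro j _
  by_cases h0 : e (Line.through a b, (ω.2 j).2.2.1) +
            e (Line.through a b, (ω.2 j).2.2.1 +
              P.vec (Line.through a b) (a + (ω.2 j).1 • b.1) (ω.2 j).2.1) = 0
  · rw [h0, bitEven_zero]
    ring
  · have hmem : ∀ l, l ∈ (selfCorrect (Line.through a b)
        (P.vec (Line.through a b) (a + (ω.2 j).1 • b.1) (ω.2 j).2.1) (ω.2 j).2.2.1 ++
      P.pointOut (a + (ω.2 j).1 • b.1) (ω.2 j).2.1 (ω.2 j).2.2.2) ::
    P.pointChecks (a + (ω.2 j).1 • b.1) (ω.2 j).2.2.2 → (l.map e).sum = 0 := fun l hl =>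
      hF.1 l (List.mem_flatten.2 ⟨_, List.mem_ofFn.2 ⟨j, rfl⟩, hl⟩)
    have h1 := hmem _ List.mem_cons_self
    rw [List.map_append, List.sum_append, sum_map_selfCorrect] at h1
    rw [bitEven_of_ne h0, fooledInd_of]
    · ring
    · refine ⟨fun l hl => hmem l (List.mem_cons_of_mem _ hl), fun h2 => h0 ?_⟩
      rwa [h2, add_zero] at h1

variable [Fintype K]

/-- The left half of a comparison test passes with probability at most `(1 + σ ^ 2 + γ) / 2`. -/
theorem expect_line_even_le (P : LineHadamardData K n d t)
    (e : Line K n × (Fin (d + 1) → Fin t → ZMod 2) → ZMod 2) {γ : ℝ} (hγ : 0 ≤ γ)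
    (hd : (d : ℝ) / Fintype.card K ≤ γ) (x : Fin n → K) (b : {b : Fin n → K // b ≠ 0}) :
    𝔼 l : K, 𝔼 w, 𝔼 r, (bitEven (e (Line.through x b, r) + e (Line.through x b, r +
      P.vec (Line.through x b) (x + l • b.1) w))) ≤
      (1 + (𝔼 v, bitSign (e (Line.through x b, v))) ^ 2 + γ) / 2 := by
  have h := expect_autocorrelation_le (blockPairing d t) exists_blockPairing_ne_zero
    (fun v => e (Line.through x b, v))
    (fun p : K × (Fin t → ZMod 2) => P.vec (Line.through x b) (x + p.1 • b.1) p.2) hγ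
    (fun α hα => (P.expect_bitSign_vec_le rfl hα).trans hd)
  rwa [expect_prod_type] at h

variable [DecidableEq K]

theorem expect_fooled_point_le (P : LineHadamardData K n d t)
    (e : Line K n × (Fin (d + 1) → Fin t → ZMod 2) → ZMod 2)
    (he : (hammingNorm e : ℝ) ≤
      1 / 1000 * Fintype.card (Line K n × (Fin (d + 1) → Fin t → ZMod 2)))
    (hd : (d : ℝ) / Fintype.card K ≤ 1 / 100) (hK : 1 / (Fintype.card K : ℝ) ≤ 1 / 100)
    (x : Fin n → K) (w : Fin t → ZMod 2) :
    𝔼 ω : PointRand K n d t,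
      (fooledInd e (P.pointOut x w ω) (P.pointChecks x ω)) ≤ 1 / 3 := by
  rcases isEmpty_or_nonempty {b : Fin n → K // b ≠ 0} with hB | hB
  · rw [expect_prod_type, Finset.univ_eq_empty, Finset.expect_empty]
    norm_num
  refine (Finset.expect_le_expect fun ω _ => P.ite_fooled_point_le e x w ω).trans ?_
  rw [Finset.expect_add_distrib]
  have hE := Line.expect_reading_error_le e he (by norm_num) x
  -- The second read of a self-corrector is also uniform in its block, so both reads have the same
  -- error bound.
  have hshift : ∀ (b : {b : Fin n → K // b ≠ 0}) (l : K) (w' : Fin t → ZMod 2)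
      (b' : {b : Fin n → K // b ≠ 0}), 𝔼 r, bitOdd (e (Line.through (x + l • b.1) b', r +
        P.vec (Line.through (x + l • b.1) b') (x + l • b.1) w')) =
      𝔼 r, bitOdd (e (Line.through (x + l • b.1) b', r)) := fun b l w' b' =>
    expect_add_right (fun r => bitOdd (e (Line.through (x + l • b.1) b', r))) _
  have hread : 𝔼 b : {b : Fin n → K // b ≠ 0}, 𝔼 τ : TestRand K n d t,
      ((bitOdd (e (Line.through (x + τ.1 • b.1) τ.2.2.2.1, τ.2.2.2.2))) +
          (bitOdd (e (Line.through (x + τ.1 • b.1) τ.2.2.2.1,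
            τ.2.2.2.2 + P.vec (Line.through (x + τ.1 • b.1) τ.2.2.2.1)
              (x + τ.1 • b.1) τ.2.1)))) ≤ 2 * (1 / Fintype.card K + 2 * (1 / 1000)) := by
    simp only [Finset.expect_add_distrib, expect_prod_type, Fintype.expect_const]
    simp only [hshift, Fintype.expect_const]
    linarith
  have hsecond : 𝔼 ω : PointRand K n d t,
      ∑ j, ((bitOdd (e (Line.through (x + (ω.2.2 j).1 • ω.1.1) (ω.2.2 j).2.2.2.1,
            (ω.2.2 j).2.2.2.2))) +
          (bitOdd (e (Line.through (x + (ω.2.2 j).1 • ω.1.1) (ω.2.2 j).2.2.2.1,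
            (ω.2.2 j).2.2.2.2 + P.vec (Line.through (x + (ω.2.2 j).1 • ω.1.1) (ω.2.2 j).2.2.2.1)
              (x + (ω.2.2 j).1 • ω.1.1) (ω.2.2 j).2.1)))) ≤
      4 * (1 / Fintype.card K + 2 * (1 / 1000)) := by
    rw [Finset.expect_sum_comm]
    have h1 : ∀ j : Fin 2, 𝔼 ω : PointRand K n d t,
        ((bitOdd (e (Line.through (x + (ω.2.2 j).1 • ω.1.1) (ω.2.2 j).2.2.2.1,
            (ω.2.2 j).2.2.2.2))) +
          (bitOdd (e (Line.through (x + (ω.2.2 j).1 • ω.1.1) (ω.2.2 j).2.2.2.1,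
            (ω.2.2 j).2.2.2.2 + P.vec (Line.through (x + (ω.2.2 j).1 • ω.1.1) (ω.2.2 j).2.2.2.1)
              (x + (ω.2.2 j).1 • ω.1.1) (ω.2.2 j).2.1)))) ≤
        2 * (1 / Fintype.card K + 2 * (1 / 1000)) := by
      intro j
      refine le_trans (le_of_eq ?_) hread
      rw [expect_prod_type]
      refine Finset.expect_congr rfl fun b _ => ?_
      rw [expect_prod_type]
      dsimp only
      rw [Fintype.expect_const]
      exact expect_pi_apply (fun τ : TestRand K n d t =>
        ((bitOdd (e (Line.through (x + τ.1 • b.1) τ.2.2.2.1, τ.2.2.2.2))) +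
          (bitOdd (e (Line.through (x + τ.1 • b.1) τ.2.2.2.1,
            τ.2.2.2.2 + P.vec (Line.through (x + τ.1 • b.1) τ.2.2.2.1)
              (x + τ.1 • b.1) τ.2.1))))) j
    rw [Fin.sum_univ_two]
    linarith [h1 0, h1 1]
  have hfirst : 𝔼 ω : PointRand K n d t,
      (bitOdd (((P.pointOut x w ω).map e).sum)) *
        ∏ j, (bitEven (e (Line.through x ω.1, (ω.2.2 j).2.2.1) +
            e (Line.through x ω.1, (ω.2.2 j).2.2.1 +
              P.vec (Line.through x ω.1) (x + (ω.2.2 j).1 • ω.1.1) (ω.2.2 j).2.1))) ≤ 13 / 50 := by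
    rw [expect_prod_type]
    refine Finset.expect_le Finset.univ_nonempty fun b _ => ?_
    have h1 := expect_mul_prod_type
      (fun r : Fin (d + 1) → Fin t → ZMod 2 =>
        bitOdd (((selfCorrect (Line.through x b) (P.vec (Line.through x b) x w) r).map e).sum))
      (fun p : Fin 2 → TestRand K n d t => ∏ j, (bitEven (e (Line.through x b, (p j).2.2.1) +
            e (Line.through x b, (p j).2.2.1 +
              P.vec (Line.through x b) (x + (p j).1 • b.1) (p j).2.1))))
    refine h1.le.trans ?_
    rw [expect_prod_pi (fun τ : TestRand K n d t => bitEven (e (Line.through x b, τ.2.2.1) +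
            e (Line.through x b, τ.2.2.1 +
              P.vec (Line.through x b) (x + τ.1 • b.1) τ.2.1)))]
    simp only [expect_prod_type, Fintype.expect_const, sum_map_selfCorrect]
    have h2 := expect_selfCorrect_le (fun v => e (Line.through x b, v))
      (P.vec (Line.through x b) x w)
    have h3 := P.expect_line_even_le e (by norm_num) hd x b
    have h4 := abs_expect_bitSign_le_one (fun v => e (Line.through x b, v))
    rw [← sq_abs] at h3
    set σ := |𝔼 v, bitSign (e (Line.through x b, v))|
    have hσ : 0 ≤ σ := abs_nonneg _
    refine (mul_le_mul h2 (pow_le_pow_left₀ (Finset.expect_nonneg fun _ _ =>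
      Finset.expect_nonneg fun _ _ => Finset.expect_nonneg fun _ _ => bitEven_nonneg _) h3 2)
      (by positivity) (by linarith)).trans ?_
    -- On `[0, 1]`, `(1 - σ)((1.01 + σ²)/2)² ≤ 0.26`. The misread term adds at most `4 · 0.012 =
    -- 0.048`, still below `1/3`.
    nlinarith [mul_nonneg hσ (sq_nonneg (σ - 1)), mul_nonneg hσ (sq_nonneg (σ ^ 2 - σ)),
      mul_nonneg hσ (sq_nonneg (σ ^ 2 - 1)), mul_nonneg hσ (sub_nonneg.2 h4),
      mul_nonneg (mul_nonneg hσ hσ) (sub_nonneg.2 h4)]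
  linarith

theorem expect_fooled_position_le (P : LineHadamardData K n d t)
    (e : Line K n × (Fin (d + 1) → Fin t → ZMod 2) → ZMod 2)
    (he : (hammingNorm e : ℝ) ≤
      1 / 1000 * Fintype.card (Line K n × (Fin (d + 1) → Fin t → ZMod 2)))
    (hd : (d : ℝ) / Fintype.card K ≤ 1 / 100) (hK : 1 / (Fintype.card K : ℝ) ≤ 1 / 100)
    (a : Fin n → K) (b : {b : Fin n → K // b ≠ 0}) (v : Fin (d + 1) → Fin t → ZMod 2) :
    𝔼 ω : PositionRand K n d t,
      (fooledInd e (selfCorrect (Line.through a b) v ω.1) (P.positionChecks a b ω)) ≤ 1 / 3 := by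
  have : Nonempty {b : Fin n → K // b ≠ 0} := ⟨b⟩
  refine (Finset.expect_le_expect fun ω _ => P.ite_fooled_position_le e a b v ω).trans ?_
  have h1 := expect_mul_prod_type
    (fun r : Fin (d + 1) → Fin t → ZMod 2 =>
      bitOdd (e (Line.through a b, r) + e (Line.through a b, r + v)))
    (fun p : Fin 3 → K × (Fin t → ZMod 2) × (Fin (d + 1) → Fin t → ZMod 2) × PointRand K n d t =>
      ∏ j, ((bitEven (e (Line.through a b, (p j).2.2.1) +
            e (Line.through a b, (p j).2.2.1 +
              P.vec (Line.through a b) (a + (p j).1 • b.1) (p j).2.1))) + (1 - (bitEven (e (Line.through a b, (p j).2.2.1) +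
            e (Line.through a b, (p j).2.2.1 +
              P.vec (Line.through a b) (a + (p j).1 • b.1) (p j).2.1)))) *
          (fooledInd e (P.pointOut (a + (p j).1 • b.1) (p j).2.1 (p j).2.2.2)
            (P.pointChecks (a + (p j).1 • b.1) (p j).2.2.2))))
  refine h1.le.trans ?_
  rw [expect_prod_pi (fun p : K × (Fin t → ZMod 2) × (Fin (d + 1) → Fin t → ZMod 2) ×
      PointRand K n d t => ((bitEven (e (Line.through a b, p.2.2.1) +
            e (Line.through a b, p.2.2.1 +
              P.vec (Line.through a b) (a + p.1 • b.1) p.2.1))) + (1 - (bitEven (e (Line.through a b, p.2.2.1) +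
            e (Line.through a b, p.2.2.1 +
              P.vec (Line.through a b) (a + p.1 • b.1) p.2.1)))) *
          (fooledInd e (P.pointOut (a + p.1 • b.1) p.2.1 p.2.2.2)
            (P.pointChecks (a + p.1 • b.1) p.2.2.2))))]
  have h2 := expect_selfCorrect_le (fun v => e (Line.through a b, v)) v
  have h3 := P.expect_line_even_le e (by norm_num) hd a b
  have h4 := abs_expect_bitSign_le_one (fun v => e (Line.through a b, v))
  rw [← sq_abs] at h3
  set σ := |𝔼 v, bitSign (e (Line.through a b, v))|
  have hσ : 0 ≤ σ := abs_nonneg _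
  -- A round passes if the line is even, and otherwise with probability at most `1/3`; so the bound
  -- is `1/3 + 2/3 · Pr[even]`.
  have h5 : 𝔼 p : K × (Fin t → ZMod 2) × (Fin (d + 1) → Fin t → ZMod 2) ×
      PointRand K n d t, ((bitEven (e (Line.through a b, p.2.2.1) +
            e (Line.through a b, p.2.2.1 +
              P.vec (Line.through a b) (a + p.1 • b.1) p.2.1))) + (1 - (bitEven (e (Line.through a b, p.2.2.1) +
            e (Line.through a b, p.2.2.1 +
              P.vec (Line.through a b) (a + p.1 • b.1) p.2.1)))) *
          (fooledInd e (P.pointOut (a + p.1 • b.1) p.2.1 p.2.2.2)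
            (P.pointChecks (a + p.1 • b.1) p.2.2.2))) ≤
      1 / 3 + 2 / 3 * ((1 + σ ^ 2 + 1 / 100) / 2) := by
    rw [expect_prod_type]
    have h6 : ∀ l : K, 𝔼 q : (Fin t → ZMod 2) × (Fin (d + 1) → Fin t → ZMod 2) ×
      PointRand K n d t, ((bitEven (e (Line.through a b, q.2.1) +
            e (Line.through a b, q.2.1 +
              P.vec (Line.through a b) (a + l • b.1) q.1))) + (1 - (bitEven (e (Line.through a b, q.2.1) +
            e (Line.through a b, q.2.1 +
              P.vec (Line.through a b) (a + l • b.1) q.1)))) *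
          (fooledInd e (P.pointOut (a + l • b.1) q.1 q.2.2)
            (P.pointChecks (a + l • b.1) q.2.2))) ≤
        1 / 3 + 2 / 3 * 𝔼 w, 𝔼 r, (bitEven (e (Line.through a b, r) + e (Line.through a b, r +
          P.vec (Line.through a b) (a + l • b.1) w))) := by
      intro l
      rw [expect_prod_type, Finset.mul_expect, ← Fintype.expect_const (ι := Fin t → ZMod 2) (1 / 3),
        ← Finset.expect_add_distrib]
      refine Finset.expect_le_expect fun w _ => ?_
      rw [expect_prod_type, Finset.mul_expect, ← Fintype.expect_const
        (ι := Fin (d + 1) → Fin t → ZMod 2) (1 / 3 : ℝ), ← Finset.expect_add_distrib]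
      refine Finset.expect_le_expect fun r _ => ?_
      simp only
      rw [Finset.expect_add_distrib, Fintype.expect_const, ← Finset.mul_expect]
      have h7 := P.expect_fooled_point_le e he hd hK (a + l • b.1) w
      nlinarith [bitEven_le_one (e (Line.through a b, r) + e (Line.through a b, r +
        P.vec (Line.through a b) (a + l • b.1) w))]
    refine (Finset.expect_le_expect fun l _ => h6 l).trans ?_
    rw [Finset.expect_add_distrib, Fintype.expect_const, ← Finset.mul_expect]
    linarith
  refine (mul_le_mul h2 (pow_le_pow_left₀ (Finset.expect_nonneg fun _ _ =>
    add_nonneg (bitEven_nonneg _) (mul_nonneg (sub_nonneg.2 (bitEven_le_one _)) (fooledInd_nonneg _ _ _))) h5 3)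
    (pow_nonneg (Finset.expect_nonneg fun _ _ =>
    add_nonneg (bitEven_nonneg _) (mul_nonneg (sub_nonneg.2 (bitEven_le_one _)) (fooledInd_nonneg _ _ _))) 3)
    (by linarith)).trans ?_
  set u := 1 / 3 + 2 / 3 * ((1 + σ ^ 2 + 1 / 100) / 2) with hu
  have hu0 : 0 ≤ u := by positivity
  have hs : 0 ≤ 1 - σ := by linarith
  -- AM-GM for `1 - σ, u, u, u`, applied as two nested two-term inequalities. The sum is `3.01 - σ +
  -- σ² ≤ 3.01`.
  have hsu : 1 - σ + 3 * u ≤ 301 / 100 := by nlinarith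
  have h8 : (1 - σ) * u ≤ ((1 - σ + u) / 2) ^ 2 := by nlinarith [sq_nonneg (1 - σ - u)]
  have h9 : (1 - σ + u) / 2 * u ≤ (301 / 400) ^ 2 := by
    nlinarith [sq_nonneg ((1 - σ + u) / 2 - u)]
  calc (1 - σ) * u ^ 3 = (1 - σ) * u * u ^ 2 := by ring
    _ ≤ ((1 - σ + u) / 2) ^ 2 * u ^ 2 := mul_le_mul_of_nonneg_right h8 (sq_nonneg _)
    _ = ((1 - σ + u) / 2 * u) ^ 2 := by ring
    _ ≤ ((301 / 400) ^ 2) ^ 2 := pow_le_pow_left₀ (by positivity) h9 2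
    _ ≤ 1 / 3 := by norm_num

end LineHadamardData

namespace LineHadamardData

variable {K : Type} [Field K] [Algebra (ZMod 2) K] {n d t : ℕ}

instance nonempty_direction [NeZero n] : Nonempty {b : Fin n → K // b ≠ 0} :=
  ⟨⟨fun _ => 1, fun h => one_ne_zero (congrFun h 0)⟩⟩

theorem isRLDC_code [Fintype K] [NeZero n] (P : LineHadamardData K n d t)
    (hd : (d : ℝ) / Fintype.card K ≤ 1 / 100) (hK : 1 / (Fintype.card K : ℝ) ≤ 1 / 100) :
    IsRLDC P.code 15 (1 / 1000) 1 (1 / 3) := by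
  classical
  exact exists_relaxedDecoder (Ω := PointRand K n d t) P.code (fun i b => b i)
    (fun i ω => P.pointOut (P.msgPts i.1) (Pi.single i.2 1) ω)
    (fun i ω => P.pointChecks (P.msgPts i.1) ω)
    (fun i ω => (P.length_pointChecks _ _ ω).le.trans (by norm_num))
    (fun b i ω => P.sum_map_pointChecks_code b _ ω)
    (fun b i ω => by
      rw [sum_map_pointOut_code, single_one_dotProduct, eval_msgPts])
    (fun e he i => P.expect_fooled_point_le e he hd hK _ _)

theorem isRLCC_code [Fintype K] [NeZero n] (P : LineHadamardData K n d t)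
    (hd : (d : ℝ) / Fintype.card K ≤ 1 / 100) (hK : 1 / (Fintype.card K : ℝ) ≤ 1 / 100)
    {q : ℕ} (hq : 38 ≤ q) : IsRLCC P.code q (1 / 1000) 1 (1 / 3) := by
  classical
  choose a b hab using Line.exists_eq_through (K := K) (n := n)
  exact exists_relaxedDecoder (Ω := PositionRand K n d t) P.code (fun u m => P.code m u)
    (fun u ω => selfCorrect (Line.through (a u.1) (b u.1)) u.2 ω.1)
    (fun u ω => P.positionChecks (a u.1) (b u.1) ω)
    (fun u ω => by
      rw [length_positionChecks]
      exact hq)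
    (fun m u ω => P.sum_map_positionChecks_code m _ _ ω)
    (fun m u ω => by rw [sum_map_selfCorrect_code, ← hab])
    (fun e he u => P.expect_fooled_position_le e he hd hK _ _ _)

theorem injective_code [NeZero n] (P : LineHadamardData K n d t) : Function.Injective P.code := by
  intro m m' h
  funext i
  obtain ⟨b⟩ := nonempty_direction (K := K) (n := n)
  have key : ∀ m, P.code m (Line.through (P.msgPts i.1) b,
      P.vec (Line.through (P.msgPts i.1) b) (P.msgPts i.1) (Pi.single i.2 1)) = m i := fun m => by
    rw [code_vec _ _ (Line.left_mem_through _ _), single_one_dotProduct, eval_msgPts]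
  rw [← key m, ← key m', h]

end LineHadamardData

/-! ### The lower bound for locally decodable codes. -/

namespace DecisionTree

variable {ι α β : Type}

/-- The positions read on the oracle string `y`. -/
def queried (y : ι → α) : DecisionTree ι α β → List ι
  | leaf _ => []
  | query j next => j :: (next (y j)).queried y

theorem length_queried (y : ι → α) (T : DecisionTree ι α β) :
    (T.queried y).length = T.numQueries y := by
  induction T with
  | leaf out => rfl
  | query j next ih => simp [queried, numQueries, ih]

theorem eval_queried_congr {y y' : ι → α} (T : DecisionTree ι α β)
    (h : ∀ j ∈ T.queried y, y j = y' j) :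
    T.eval y = T.eval y' ∧ T.queried y = T.queried y' := by
  induction T with
  | leaf out => exact ⟨rfl, rfl⟩
  | query j next ih =>
    have hj : y j = y' j := h j List.mem_cons_self
    have := ih (y j) fun i hi => h i (List.mem_cons_of_mem _ hi)
    simp only [eval, queried, ← hj, this.1, this.2, and_self]

end DecisionTree

section LowerBound

variable {κ ι : Type} [Fintype κ] [DecidableEq κ] [DecidableEq ι]

/-- If, for every set of at most `q` positions, some message `s` with `s i = 1` has an encoding that
vanishes on those positions outside `S`, then after deleting the positions in `S` the output of a
`q`-query decision tree for the bit `i` is wrong for half of the messages. -/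
theorem two_mul_card_wrong (C : (κ → ZMod 2) →ₗ[ZMod 2] (ι → ZMod 2)) (i : κ) (S : Finset ι)
    {q : ℕ} (hS : ∀ l : List ι, l.length ≤ q → ∃ s : κ → ZMod 2, s i = 1 ∧
      ∀ j ∈ l, j ∉ S → C s j = 0) (T : DecisionTree ι (ZMod 2) (ZMod 2))
    (hT : ∀ y, T.numQueries y ≤ q) :
    2 * (Finset.univ.filter fun b : κ → ZMod 2 =>
      T.eval (fun j => if j ∈ S then 0 else C b j) ≠ b i).card =
      Fintype.card (κ → ZMod 2) := by
  have hS' : ∀ l : List ι, ∃ s : κ → ZMod 2, l.length ≤ q → s i = 1 ∧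
      ∀ j ∈ l, j ∉ S → C s j = 0 := fun l => by
    by_cases h : l.length ≤ q
    · obtain ⟨s, hs⟩ := hS l h
      exact ⟨s, fun _ => hs⟩
    · exact ⟨0, fun h' => absurd h' h⟩
  choose s hs using hS'
  set y : (κ → ZMod 2) → ι → ZMod 2 := fun b j => if j ∈ S then 0 else C b j with hy
  -- The shift depends on the positions read along the path of `b`, which takes care of adaptivity.
  -- The shifted message follows the same path, so `φ` is an involution that flips bit `i` and keeps
  -- the output; it matches right with wrong answers.
  set φ : (κ → ZMod 2) → κ → ZMod 2 := fun b => b + s (T.queried (y b)) with hφ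
  have hlen : ∀ b, (T.queried (y b)).length ≤ q := fun b =>
    (DecisionTree.length_queried _ _).le.trans (hT _)
  have hagree : ∀ b, T.eval (y b) = T.eval (y (φ b)) ∧
      T.queried (y b) = T.queried (y (φ b)) := by
    intro b
    refine T.eval_queried_congr fun j hj => ?_
    simp only [hy, hφ, map_add, Pi.add_apply]
    split_ifs with hjS
    · rfl
    · rw [(hs _ (hlen b)).2 j hj hjS, add_zero]
  have hinv : ∀ b, φ (φ b) = b := by
    intro b
    show φ b + s (T.queried (y (φ b))) = b
    rw [← (hagree b).2]
    simp only [hφ, add_assoc]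
    rw [show s (T.queried (y b)) + s (T.queried (y b)) = 0 from
      funext fun _ => zmod_two_add_self _, add_zero]
  have hbit : ∀ b, φ b i = b i + 1 := fun b => by
    simp only [hφ, Pi.add_apply, (hs _ (hlen b)).1]
  have hz : ∀ u v : ZMod 2, u ≠ v ↔ u = v + 1 := by decide
  have hcard : (Finset.univ.filter fun b => T.eval (y b) ≠ b i).card =
      (Finset.univ.filter fun b => ¬ T.eval (y b) ≠ b i).card := by
    refine Finset.card_nbij' φ φ ?_ ?_ (fun b _ => hinv b) (fun b _ => hinv b)
    · intro b hb
      simp only [Finset.coe_filter, Finset.mem_univ, true_and, Set.mem_ofPred_eq, not_not] at hb ⊢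
      rw [← (hagree b).1, hbit, ← hz]
      exact hb
    · intro b hb
      simp only [Finset.coe_filter, Finset.mem_univ, true_and, Set.mem_ofPred_eq, not_not] at hb ⊢
      rw [← (hagree b).1, hbit, hz, hb]
      have : ∀ u : ZMod 2, u = u + 1 + 1 := by decide
      exact this _
  rw [two_mul]
  nth_rewrite 2 [hcard]
  rw [Finset.card_filter_add_card_filter_not, Finset.card_univ]

/-- Averaging over all messages, each tree in the support is wrong exactly half of the time, so some
message has error at least `1/2`. Zeroing `S` stays within the decoding radius. -/
theorem not_isLDC_of_shift [Fintype ι] (C : (κ → ZMod 2) →ₗ[ZMod 2] (ι → ZMod 2)) (i : κ) (S : Finset ι)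
    {q : ℕ} (hS : ∀ l : List ι, l.length ≤ q → ∃ s : κ → ZMod 2, s i = 1 ∧
      ∀ j ∈ l, j ∉ S → C s j = 0) {ρ c η : ℝ} (hρ : (S.card : ℝ) ≤ ρ * Fintype.card ι)
    (hη : 0 < η) : ¬ IsLDC C q ρ c (1 / 2 - η) := by
  classical
  rintro ⟨Dec, hq, -, hs⟩
  set y : (κ → ZMod 2) → ι → ZMod 2 := fun b j => if j ∈ S then 0 else C b j with hy
  have hdist : ∀ b, (hammingDist (y b) (C b) : ℝ) ≤ ρ * Fintype.card ι := by
    intro b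
    refine le_trans ?_ hρ
    refine Nat.cast_le.2 (Finset.card_le_card fun j hj => ?_)
    by_contra hjS
    simp [hy, hjS] at hj
  have h1 : ∑ b, (Dec i).toOuterMeasure {T | T.eval (y b) ∈ ({b i}ᶜ : Set (ZMod 2))} * 2 =
      (Fintype.card (κ → ZMod 2) : ENNReal) := by
    simp only [PMF.toOuterMeasure_apply]
    rw [← Finset.sum_mul, ← Summable.tsum_finsetSum (fun _ _ => ENNReal.summable),
      ← ENNReal.tsum_mul_right]
    have h2 : ∀ T, (∑ b, Set.indicator {T | T.eval (y b) ∈ ({b i}ᶜ : Set (ZMod 2))} (Dec i) T) * 2 =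
        Dec i T * Fintype.card (κ → ZMod 2) := by
      intro T
      by_cases hT : T ∈ (Dec i).support
      · rw [← two_mul_card_wrong C i S hS T (hq i T hT)]
        simp only [Set.indicator_apply, Set.mem_ofPred_eq, Set.mem_compl_iff, Set.mem_singleton_iff]
        rw [← Finset.sum_filter, Finset.sum_const, nsmul_eq_mul, Nat.cast_mul, Nat.cast_two]
        ring
      · rw [PMF.mem_support_iff, not_not] at hT
        simp [Set.indicator_apply, hT]
    simp only [h2]
    rw [ENNReal.tsum_mul_right, PMF.tsum_coe, one_mul]
  have h3 : ∀ b, ((Dec i).toOuterMeasure {T | T.eval (y b) ∈ ({b i}ᶜ : Set (ZMod 2))}).toReal ≤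
      1 / 2 - η := fun b => hs b i (y b) (hdist b)
  have h4 := congrArg ENNReal.toReal h1
  have h5 : ∀ b, (Dec i).toOuterMeasure {T | T.eval (y b) ∈ ({b i}ᶜ : Set (ZMod 2))} * 2 ≠ ⊤ := by
    intro b h
    have h6 := ENNReal.sum_eq_top (f := fun b => (Dec i).toOuterMeasure
      {T | T.eval (y b) ∈ ({b i}ᶜ : Set (ZMod 2))} * 2).2 ⟨b, Finset.mem_univ b, h⟩
    rw [h1] at h6
    exact ENNReal.natCast_ne_top _ h6
  rw [ENNReal.toReal_sum fun b _ => h5 b] at h4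
  simp only [ENNReal.toReal_mul, ENNReal.toReal_ofNat, ENNReal.toReal_natCast] at h4
  have h6 := Finset.sum_le_sum fun b (_ : b ∈ (Finset.univ : Finset (κ → ZMod 2))) =>
    mul_le_mul_of_nonneg_right (h3 b) (zero_le_two (α := ℝ))
  rw [h4, Finset.sum_const, Finset.card_univ, nsmul_eq_mul] at h6
  have h7 : (0 : ℝ) < Fintype.card (κ → ZMod 2) := by exact_mod_cast Fintype.card_pos
  nlinarith

end LowerBound

/-! ### Polynomials vanishing on lines, and dimension counts. -/

section AffineForms

variable {K : Type} [Field K] {n : ℕ}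

/-- A line that misses `x` lies in the zero set of an affine form that does not vanish at `x`. -/
theorem Line.exists_affine (L : Line K n) {x : Fin n → K} (hx : x ∉ L.1) :
    ∃ h : MvPolynomial (Fin n) K, h.totalDegree ≤ 1 ∧ MvPolynomial.eval x h ≠ 0 ∧
      ∀ z ∈ L.1, MvPolynomial.eval z h = 0 := by
  obtain ⟨a, b, rfl⟩ := L.exists_eq_through
  have hxa : x - a ∉ Submodule.span K {b.1} := by
    intro h
    obtain ⟨l, hl⟩ := Submodule.mem_span_singleton.1 h
    exact hx ⟨l, by simp [hl]⟩
  -- The affine form is `z ↦ f (z - a)`, where `f` kills the direction but not `x - a`.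
  obtain ⟨f, hf, hker⟩ := Submodule.exists_le_ker_of_notMem hxa
  have heval : ∀ z, MvPolynomial.eval z (∑ i, MvPolynomial.C (f (Pi.single i 1)) *
      (MvPolynomial.X i - MvPolynomial.C (a i))) = f (z - a) := by
    intro z
    simp only [map_sum, map_mul, map_sub (MvPolynomial.eval z), MvPolynomial.eval_C,
      MvPolynomial.eval_X]
    conv_rhs => rw [pi_eq_sum_univ' (z - a), map_sum]
    refine Finset.sum_congr rfl fun i _ => ?_
    rw [map_smul, smul_eq_mul, mul_comm, Pi.sub_apply]
  refine ⟨_, ?_, (heval x).trans_ne hf, ?_⟩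
  · refine MvPolynomial.totalDegree_finsetSum_le fun i _ => ?_
    refine (MvPolynomial.totalDegree_mul _ _).trans ?_
    rw [MvPolynomial.totalDegree_C, zero_add]
    refine (MvPolynomial.totalDegree_sub_C_le _ _).trans ?_
    rw [MvPolynomial.totalDegree_X]
  · rintro _ ⟨l, rfl⟩
    rw [heval, add_sub_cancel_left, map_smul,
      LinearMap.mem_ker.1 (hker (Submodule.mem_span_singleton_self _)), smul_zero]

theorem Line.exists_poly_vanishing (l : List (Line K n)) (x : Fin n → K) :
    ∃ g : MvPolynomial (Fin n) K, g.totalDegree ≤ l.length ∧ MvPolynomial.eval x g ≠ 0 ∧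
      ∀ L ∈ l, x ∉ L.1 → ∀ z ∈ L.1, MvPolynomial.eval z g = 0 := by
  induction l with
  | nil => exact ⟨1, by simp, by simp, by simp⟩
  | cons L l ih =>
    obtain ⟨g, hg, hgx, hgl⟩ := ih
    by_cases hx : x ∈ L.1
    · refine ⟨g, hg.trans (by simp), hgx, fun L' hL' hxL' => ?_⟩
      rcases List.mem_cons.1 hL' with rfl | hL'
      · exact absurd hx hxL'
      · exact hgl L' hL' hxL'
    · obtain ⟨h, hh, hhx, hhL⟩ := L.exists_affine hx
      refine ⟨g * h, (MvPolynomial.totalDegree_mul _ _).trans ?_, ?_, fun L' hL' hxL' z hz => ?_⟩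
      · rw [List.length_cons]
        exact add_le_add hg hh
      · rw [map_mul]
        exact mul_ne_zero hgx hhx
      · rw [map_mul]
        rcases List.mem_cons.1 hL' with rfl | hL'
        · rw [hhL z hz, mul_zero]
        · rw [hgl L' hL' hxL' z hz, zero_mul]

end AffineForms

theorem sum_range_choose_add (n d : ℕ) :
    ∑ k ∈ Finset.range (d + 1), (n + k - 1).choose k = (n + d).choose d := by
  induction d with
  | zero => simp
  | succ d ih =>
    rw [Finset.sum_range_succ, ih, show n + (d + 1) - 1 = n + d from rfl, ← add_assoc,
      Nat.choose_succ_succ]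

/-- Count monomials degree by degree and sum with the hockey-stick identity. This dimension makes
every systematic encoding onto. -/
theorem finrank_restrictTotalDegree (K : Type) [Field K] (n d : ℕ) :
    Module.finrank K (MvPolynomial.restrictTotalDegree (Fin n) K d) = (n + d).choose d := by
  classical
  have hset : {s : Fin n →₀ ℕ | (s.sum fun _ e => e) ≤ d} =
      ((Finset.range (d + 1)).biUnion fun k => (Finset.univ : Finset (Fin n)).finsuppAntidiag k :
        Finset (Fin n →₀ ℕ)) := by
    ext s
    simp only [Set.mem_ofPred_eq, Finset.coe_biUnion, Set.mem_iUnion, Finset.mem_coe,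
      Finset.mem_finsuppAntidiag, Finset.mem_range, Finset.subset_univ, and_true, exists_prop]
    rw [Finsupp.sum_fintype _ _ fun _ => rfl]
    exact ⟨fun h => ⟨_, Nat.lt_succ_of_le h, rfl⟩, fun ⟨k, hk, h⟩ => h ▸ Nat.le_of_lt_succ hk⟩
  have h := Module.finrank_eq_nat_card_basis
    (MvPolynomial.basisRestrictSupport K {s : Fin n →₀ ℕ | (s.sum fun _ e => e) ≤ d})
  refine h.trans ?_
  rw [hset, Nat.card_eq_fintype_card]
  simp only [Finset.coe_sort_coe, Fintype.card_coe]
  rw [Finset.card_biUnion]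
  · simp only [Finset.card_finsuppAntidiag_nat_eq_choose, Finset.card_univ, Fintype.card_fin]
    exact sum_range_choose_add n d
  · intro k _ k' _ hkk'
    rw [Function.onFun, Finset.disjoint_left]
    intro s hs hs'
    rw [Finset.mem_finsuppAntidiag] at hs hs'
    exact hkk' (hs.1.symm.trans hs'.1)

theorem exists_fin_basis_of_span {K W : Type} [Field K] [AddCommGroup W] [Module K W]
    [Module.Finite K W] {s : Set W} (hs : Submodule.span K s = ⊤) {m : ℕ}
    (hm : Module.finrank K W = m) :
    ∃ B : Module.Basis (Fin m) K W, Set.range B ⊆ s := by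
  have hfin := Module.Finite.finite_basis (Module.Basis.ofSpan hs.ge)
  have hcard := Module.finrank_eq_nat_card_basis (Module.Basis.ofSpan hs.ge)
  refine ⟨(Module.Basis.ofSpan hs.ge).reindex (Finite.equivFinOfCardEq (hcard.symm.trans hm)), ?_⟩
  rw [Module.Basis.range_reindex]
  exact Module.Basis.ofSpan_subset hs.ge

theorem Line.card_through_le {K : Type} [Field K] {n : ℕ} [Fintype K] (x : Fin n → K)
    (S : Finset (Line K n)) (hS : ∀ L ∈ S, x ∈ L.1) : S.card ≤ Fintype.card K ^ n := by
  classical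
  have hdir : ∀ L : Line K n, ∃ b : Fin n → K, x ∈ L.1 → L.1 = Set.range fun l : K => x + l • b := by
    intro L
    by_cases hx : x ∈ L.1
    · obtain ⟨a, b, rfl⟩ := L.exists_eq_through
      obtain ⟨l, hl⟩ := hx
      have h : Line.through x b = Line.through a b :=
        (Line.through_eq_through_iff a x b b).2 ⟨l, 1, hl.symm, by simp⟩
      exact ⟨b.1, fun _ => by rw [← h]; rfl⟩
    · exact ⟨0, fun h => absurd h hx⟩
  choose f hf using hdir
  refine (Finset.card_le_card_of_injOn f (t := Finset.univ) (fun _ _ => Finset.mem_coe.2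
    (Finset.mem_univ _)) fun L hL L' hL' h => Subtype.ext ?_).trans ?_
  · rw [hf L (hS L hL), hf L' (hS L' hL'), h]
  · rw [Finset.card_univ, Fintype.card_fun, Fintype.card_fin]

namespace LineHadamardData

variable {K : Type} [Field K] [Algebra (ZMod 2) K] {n d t : ℕ}

theorem surjective_enc (P : LineHadamardData K n d t) : Function.Surjective P.enc := by
  have hinj : Function.Injective P.enc := fun a a' h => funext fun i => by
    rw [← P.eval_enc a i, h, P.eval_enc]
  refine (LinearMap.injective_iff_surjective_of_finrank_eq_finrank ?_).1 hinj
  rw [finrank_restrictTotalDegree, Module.finrank_fin_fun]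

theorem exists_poly_eq (P : LineHadamardData K n d t) {g : MvPolynomial (Fin n) K}
    (hg : g.totalDegree ≤ d) : ∃ s, P.poly s = g := by
  obtain ⟨a, ha⟩ := P.surjective_enc ⟨g, (MvPolynomial.mem_restrictTotalDegree _ _ _).2 hg⟩
  refine ⟨fun p => P.basis.equivFun (a p.1) p.2, ?_⟩
  simp only [poly]
  rw [show (fun i => P.basis.equivFun.symm fun j => P.basis.equivFun (a i) j) = a from
    funext fun i => P.basis.equivFun.symm_apply_apply (a i), ha]

/-- A message with a prescribed bit equal to `1` whose encoding vanishes on the blocks of at most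
`d` given lines that miss the evaluation point of that bit. -/
theorem exists_message_vanishing (P : LineHadamardData K n d t)
    (i : Fin ((n + d).choose d) × Fin t) (l : List (Line K n)) (hl : l.length ≤ d) :
    ∃ s, s i = 1 ∧ ∀ L ∈ l, P.msgPts i.1 ∉ L.1 → ∀ v, P.code s (L, v) = 0 := by
  obtain ⟨g, hg, hgx, hgl⟩ := Line.exists_poly_vanishing l (P.msgPts i.1)
  obtain ⟨s, hs⟩ := P.exists_poly_eq
    (g := MvPolynomial.C (P.basis i.2 / MvPolynomial.eval (P.msgPts i.1) g) * g) (by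
      refine (MvPolynomial.totalDegree_mul _ _).trans ?_
      rw [MvPolynomial.totalDegree_C, zero_add]
      exact hg.trans hl)
  refine ⟨s, ?_, fun L hL hx v => ?_⟩
  · rw [← P.eval_msgPts s i.1 i.2, hs, map_mul, MvPolynomial.eval_C, div_mul_cancel₀ _ hgx]
    simp
  · rw [code_apply, hs]
    refine Finset.sum_eq_zero fun j _ => ?_
    rw [map_mul, hgl L hL hx _ (P.pts_mem L j), mul_zero, map_zero, dotProduct_zero]

/-- The erased set consists of the blocks of all lines through the evaluation point. Their number is
bounded by the number of direction vectors, `|K|^n`. -/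
theorem not_isLDC_code [Fintype K] (P : LineHadamardData K n d t)
    (i : Fin ((n + d).choose d) × Fin t) {q : ℕ} (hq : q ≤ d) {ρ c η : ℝ}
    (hρ : ((Fintype.card K ^ n * (2 ^ t) ^ (d + 1) : ℕ) : ℝ) ≤
      ρ * Fintype.card (Line K n × (Fin (d + 1) → Fin t → ZMod 2)))
    (hη : 0 < η) : ¬ IsLDC P.code q ρ c (1 / 2 - η) := by
  classical
  refine not_isLDC_of_shift P.code i ((Finset.univ.filter fun L : Line K n =>
    P.msgPts i.1 ∈ L.1) ×ˢ Finset.univ) (fun l hl => ?_) (le_trans ?_ hρ) hη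
  · obtain ⟨s, hs, hsl⟩ := P.exists_message_vanishing i (l.map Prod.fst)
      (by rw [List.length_map]; exact hl.trans hq)
    refine ⟨s, hs, fun u hu huS => hsl u.1 (List.mem_map_of_mem hu) (fun hx => huS ?_) u.2⟩
    simpa using hx
  · rw [Finset.card_product, Nat.cast_le]
    refine Nat.mul_le_mul (Line.card_through_le (P.msgPts i.1) _ fun L hL => (Finset.mem_filter.1 hL).2) ?_
    simp

/-- Since `d < |K|`, no nonzero polynomial of degree at most `d` vanishes on all of `K^n`. So
evaluations span the dual space and contain a basis of it, whose points carry the message; `S_L`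
exists because a line has `|K| > d` points. -/
theorem nonempty_of_card [Fintype K] (hK : Fintype.card K = 2 ^ t) (hd : d < 2 ^ t) :
    Nonempty (LineHadamardData K n d t) := by
  classical
  have hfin : Module.finrank (ZMod 2) K = t := by
    have h := Module.card_eq_pow_finrank (K := ZMod 2) (V := K)
    rw [ZMod.card, hK] at h
    exact (Nat.pow_right_injective le_rfl h).symm
  have hpts : ∀ L : Line K n, ∃ p : Fin (d + 1) → (Fin n → K),
      (∀ j, p j ∈ L.1) ∧ Function.Injective p := by
    intro L
    obtain ⟨a, b, rfl⟩ := L.exists_eq_through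
    obtain ⟨φ⟩ : Nonempty (Fin (d + 1) ↪ K) :=
      Function.Embedding.nonempty_of_card_le (by rw [Fintype.card_fin, hK]; exact hd)
    exact ⟨fun j => a + φ j • b.1, fun j => ⟨φ j, rfl⟩,
      (Line.injective_param a b).comp φ.injective⟩
  choose pts hmem hinj using hpts
  set V := MvPolynomial.restrictTotalDegree (Fin n) K d with hV
  let ev : (Fin n → K) → Module.Dual K V := fun x =>
    (MvPolynomial.aeval x).toLinearMap ∘ₗ V.subtype
  have hev : ∀ x (f : V), ev x f = MvPolynomial.eval x (f : MvPolynomial (Fin n) K) := fun x f => by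
    simp [ev, MvPolynomial.aeval_eq_eval]
  have hspan : Submodule.span K (Set.range ev) = ⊤ := by
    refine Submodule.span_eq_top_of_ne_zero fun f hf => ?_
    by_contra! h
    refine hf (Subtype.ext ?_)
    refine MvPolynomial.eq_zero_of_eval_zero_at_prod_finset _ (fun _ => Finset.univ) (fun i => ?_)
      fun x _ => ?_
    · rw [Finset.card_univ, hK]
      exact ((MvPolynomial.degreeOf_le_totalDegree _ i).trans
        ((MvPolynomial.mem_restrictTotalDegree _ _ _).1 f.2)).trans_lt hd
    · rw [← hev]
      exact h _ ⟨x, rfl⟩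
  have hrank : Module.finrank K (Module.Dual K V) = (n + d).choose d := by
    rw [Subspace.dual_finrank_eq, finrank_restrictTotalDegree]
  obtain ⟨B, hB⟩ := exists_fin_basis_of_span hspan hrank
  choose x hx using fun i => hB ⟨i, rfl⟩
  let Φ : V →ₗ[K] Fin ((n + d).choose d) → K := LinearMap.pi fun i => ev (x i)
  have hΦinj : Function.Injective Φ := by
    rw [← LinearMap.ker_eq_bot, LinearMap.ker_eq_bot']
    intro f hf
    refine (Module.forall_dual_apply_eq_zero_iff K f).1 fun φ => ?_
    rw [← B.sum_repr φ, LinearMap.sum_apply]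
    refine Finset.sum_eq_zero fun i _ => ?_
    rw [LinearMap.smul_apply, ← hx i, show ev (x i) f = 0 from congrFun hf i, smul_zero]
  let E : V ≃ₗ[K] Fin ((n + d).choose d) → K := LinearEquiv.ofInjectiveOfFinrankEq Φ hΦinj (by
    rw [finrank_restrictTotalDegree, Module.finrank_fin_fun])
  refine ⟨⟨Module.finBasisOfFinrankEq (ZMod 2) K hfin, pts, hmem, hinj, x, E.symm.toLinearMap,
    fun a i => ?_⟩⟩
  rw [← hev]
  exact congrFun (E.apply_symm_apply a) i

end LineHadamardData

/-! ### Parameter estimates and the separation for part (a). -/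

theorem two_pow_le_choose {n d : ℕ} (h : d ≤ n) : 2 ^ d ≤ (n + d).choose d := by
  induction d with
  | zero => simp
  | succ d ih =>
    have h1 := Nat.add_one_mul_choose_eq (n + d) d
    have h2 := ih (by omega)
    refine Nat.le_of_mul_le_mul_right (c := d + 1) ?_ (Nat.succ_pos d)
    rw [← add_assoc, ← h1, pow_succ]
    calc 2 ^ d * 2 * (d + 1) = (2 * (d + 1)) * 2 ^ d := by ring
      _ ≤ (n + d + 1) * (n + d).choose d := Nat.mul_le_mul (by omega) h2

theorem succ_le_choose {n d : ℕ} (hd : 1 ≤ d) : n + 1 ≤ (n + d).choose d := by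
  obtain ⟨d, rfl⟩ : ∃ e, d = e + 1 := ⟨d - 1, by omega⟩
  induction d with
  | zero => simp
  | succ d ih =>
    refine (ih (by omega)).trans ?_
    rw [show n + (d + 1 + 1) = n + (d + 1) + 1 by ring, Nat.choose_succ_succ]
    exact Nat.le_add_right _ _

theorem le_rpow_of_log_le {x k B : ℝ} (hx : 0 < x) (hk : 0 < k)
    (h : Real.log x ≤ B * Real.log (Real.log k) * Real.log k) :
    x ≤ k ^ (B * Real.log (Real.log k)) :=
  (Real.le_rpow_iff_log_le hx hk).2 h

/-- As `N^(-1/3) · N = N^(2/3)`, comparing cubes turns the radius condition into one on integers. -/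
theorem le_rpow_mul_of_cube_le {A N D : ℝ} (hN : 0 < N) (hD : 1 ≤ D)
    (h : A ^ 3 ≤ N ^ 2) : A ≤ D * N ^ (-(1 / 3) : ℝ) * N := by
  have h1 : 0 < N ^ (-(1 / 3) : ℝ) := Real.rpow_pos_of_pos hN _
  have h2 : (N ^ (-(1 / 3) : ℝ)) ^ 3 = N⁻¹ := by
    rw [← Real.rpow_natCast, ← Real.rpow_mul hN.le, ← Real.rpow_neg_one]
    norm_num
  have h3 : A ≤ N ^ (-(1 / 3) : ℝ) * N := by
    refine le_of_pow_le_pow_left₀ (n := 3) (by norm_num) (by positivity) ?_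
    rw [mul_pow, h2]
    calc A ^ 3 ≤ N ^ 2 := h
      _ = N⁻¹ * N ^ 3 := by field_simp
  refine h3.trans (mul_le_mul_of_nonneg_right ?_ hN.le)
  nlinarith

section LineCount

variable (K : Type) [Field K] [Fintype K] (n : ℕ)

theorem Line.card_mul_eq :
    Fintype.card K * (Fintype.card K - 1) * Fintype.card (Line K n) =
      Fintype.card K ^ n * (Fintype.card K ^ n - 1) := by
  classical
  have h := Line.card_mul_card (K := K) (n := n)
  rw [Fintype.card_prod, Fintype.card_units, Fintype.card_prod, Fintype.card_fun,
    Fintype.card_fin, Fintype.card_subtype_compl, Fintype.card_subtype_eq, Fintype.card_fun,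
    Fintype.card_fin] at h
  exact h

theorem Line.card_le : Fintype.card (Line K n) ≤ Fintype.card K ^ (2 * n) := by
  have h := Line.card_mul_eq K n
  have hK : 1 < Fintype.card K := Fintype.one_lt_card
  calc Fintype.card (Line K n)
      ≤ Fintype.card K * (Fintype.card K - 1) * Fintype.card (Line K n) :=
        Nat.le_mul_of_pos_left _ (Nat.mul_pos (by omega) (by omega))
    _ = _ := h
    _ ≤ Fintype.card K ^ n * Fintype.card K ^ n := Nat.mul_le_mul_left _ (Nat.sub_le _ _)
    _ = _ := by rw [two_mul, pow_add]

theorem Line.le_card (hn : 2 ≤ n) : Fintype.card K ^ (2 * n - 3) ≤ Fintype.card (Line K n) := by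
  have h := Line.card_mul_eq K n
  have hK : 1 < Fintype.card K := Fintype.one_lt_card
  set Q := Fintype.card K
  obtain ⟨m, rfl⟩ : ∃ m, n = m + 2 := ⟨n - 2, by omega⟩
  refine le_of_mul_le_mul_left (a := Q * Q) ?_ (by positivity)
  have hpos : 1 ≤ Q ^ (m + 1) := Nat.one_le_pow _ _ (by omega)
  have h1 : Q ^ (m + 1) ≤ Q ^ (m + 2) - 1 := by
    have h2 : Q ^ (m + 1) * 2 ≤ Q ^ (m + 2) := by
      rw [pow_succ Q (m + 1)]
      exact Nat.mul_le_mul_left _ hK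
    omega
  calc Q * Q * Q ^ (2 * (m + 2) - 3) = Q ^ (m + 2) * Q ^ (m + 1) := by
        rw [show 2 * (m + 2) - 3 = 2 * m + 1 by omega]
        ring
    _ ≤ Q ^ (m + 2) * (Q ^ (m + 2) - 1) := Nat.mul_le_mul_left _ h1
    _ = Q * (Q - 1) * Fintype.card (Line K (m + 2)) := h.symm
    _ ≤ Q * Q * Fintype.card (Line K (m + 2)) :=
        Nat.mul_le_mul_right _ (Nat.mul_le_mul_left _ (Nat.sub_le _ _))

end LineCount

/-- The parameter bounds behind the blocklength and the number of queries. -/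
theorem log_bounds {a : ℝ} (ha : 0 < a) (r : ℕ) {n d t : ℕ} (hn : 100 ≤ n) (had : a * n ≤ d)
    (hdn : d ≤ n) (hd : 1 ≤ d) (ht : 1 ≤ t) (hr : 2 ^ t ≤ n ^ r) :
    4 * n * (t * Real.log 2) ≤ 4 * (r + 1) * (1 + |Real.log (a * Real.log 2)|) / (a * Real.log 2) *
      Real.log (Real.log ((n + d).choose d * t : ℕ)) * Real.log ((n + d).choose d * t : ℕ) ∧
    a / (r + 2) * Real.log ((n + d).choose d * t : ℕ) ≤ d := by
  have hlog2 : 0 < Real.log 2 := Real.log_pos (by norm_num)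
  have hlog2' : Real.log 2 ≤ 1 := by linarith [Real.log_two_lt_d9]
  have hn0 : (100 : ℝ) ≤ n := by exact_mod_cast hn
  have hM2 : (2 : ℝ) ^ d ≤ (n + d).choose d := by exact_mod_cast two_pow_le_choose hdn
  have hMn : (n : ℝ) + 1 ≤ (n + d).choose d := by exact_mod_cast succ_le_choose hd
  have hMu : ((n + d).choose d : ℝ) ≤ 2 ^ (n + d) := by exact_mod_cast Nat.choose_le_two_pow _ _
  have ht1 : (1 : ℝ) ≤ t := by exact_mod_cast ht
  have htr : t * Real.log 2 ≤ r * Real.log n := by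
    rw [← Real.log_pow, ← Real.log_pow]
    exact Real.log_le_log (by positivity) (by exact_mod_cast hr)
  have hlogn : 0 ≤ Real.log n := Real.log_nonneg (by linarith)
  have hlogn' : Real.log n ≤ n := (Real.log_le_sub_one_of_pos (by linarith)).trans (by linarith)
  rw [Nat.cast_mul]
  set M : ℝ := (((n + d).choose d : ℕ) : ℝ)
  have hMpos : 0 < M := by linarith
  have hkM : M ≤ M * t := le_mul_of_one_le_right hMpos.le ht1
  have hlk : Real.log (M * t) = Real.log M + Real.log t :=
    Real.log_mul hMpos.ne' (by positivity)
  have hlow : a * Real.log 2 * n ≤ Real.log (M * t) := by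
    calc a * Real.log 2 * n = (a * n) * Real.log 2 := by ring
      _ ≤ d * Real.log 2 := by gcongr
      _ = Real.log (2 ^ d) := by rw [Real.log_pow]
      _ ≤ Real.log (M * t) := Real.log_le_log (by positivity) (hM2.trans hkM)
  -- `M t > 100 > 3^4 > e^4`. As `4 > e`, this makes the iterated logarithm at least `1`, so
  -- additive constants in `log n` can be absorbed into a factor.
  have hlow4 : 4 ≤ Real.log (M * t) := by
    rw [Real.le_log_iff_exp_le (by positivity)]
    have h1 : Real.exp 4 = Real.exp 1 ^ 4 := by rw [← Real.exp_nat_mul]; norm_num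
    rw [h1]
    have h2 : Real.exp 1 ^ 4 ≤ 3 ^ 4 :=
      pow_le_pow_left₀ (Real.exp_pos 1).le (by linarith [Real.exp_one_lt_d9]) 4
    linarith
  set k := Real.log (M * t) with hk
  have hll1 : 1 ≤ Real.log k := by
    rw [Real.le_log_iff_exp_le (by linarith)]
    linarith [Real.exp_one_lt_d9]
  have ha' : 0 < a * Real.log 2 := by positivity
  have hll2 : Real.log n ≤ (1 + |Real.log (a * Real.log 2)|) * Real.log k := by
    have h1 := Real.log_le_log (by positivity) hlow
    rw [Real.log_mul ha'.ne' (by positivity)] at h1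
    nlinarith [neg_abs_le (Real.log (a * Real.log 2)), abs_nonneg (Real.log (a * Real.log 2))]
  constructor
  · have h1 : (n : ℝ) ≤ k / (a * Real.log 2) := by
      rw [le_div_iff₀ ha']
      linarith
    calc 4 * n * (t * Real.log 2) ≤ 4 * n * ((r + 1) * Real.log n) :=
          mul_le_mul_of_nonneg_left (by linarith) (by positivity)
      _ ≤ 4 * (k / (a * Real.log 2)) * ((r + 1) *
            ((1 + |Real.log (a * Real.log 2)|) * Real.log k)) := by gcongr
      _ = _ := by ring
  · have h1 : Real.log M ≤ 2 * n := by
      calc Real.log M ≤ Real.log (2 ^ (n + d)) := Real.log_le_log hMpos hMu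
        _ = (n + d : ℕ) * Real.log 2 := by rw [Real.log_pow]
        _ ≤ (n + d : ℕ) * 1 := by gcongr
        _ ≤ 2 * n := by
          push_cast
          have : (d : ℝ) ≤ n := by exact_mod_cast hdn
          linarith
    have h2 : Real.log t ≤ r * n := by
      calc Real.log t ≤ Real.log (2 ^ t) :=
            Real.log_le_log (by positivity) (by exact_mod_cast Nat.lt_two_pow_self.le)
        _ = t * Real.log 2 := by rw [Real.log_pow]
        _ ≤ r * Real.log n := htr
        _ ≤ r * n := by gcongr
    rw [div_mul_eq_mul_div, div_le_iff₀ (by positivity)]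
    calc a * k ≤ a * ((r + 2) * n) := by
          gcongr
          rw [hlk]
          linarith
      _ = (a * n) * (r + 2) := by ring
      _ ≤ d * (r + 2) := by gcongr

namespace LineHadamardData

variable {K : Type} [Field K] [Algebra (ZMod 2) K] {n d t : ℕ}

theorem isSeparatingCode [Fintype K] (hK : Fintype.card K = 2 ^ t) {a : ℝ} (ha : 0 < a) (r : ℕ)
    (hn : 100 ≤ n) (hd : 1 ≤ d) (had : a * n ≤ d) (hdn : 100 * d ≤ n) (hnt : n ≤ 2 ^ t)
    (htr : 2 ^ t ≤ n ^ r) (P : LineHadamardData K n d t) :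
    IsSeparatingCode P.code (1 / 1000) (1 / 6)
      (4 * (r + 1) * (1 + |Real.log (a * Real.log 2)|) / (a * Real.log 2)) (a / (r + 2)) 1 := by
  have : NeZero n := ⟨by omega⟩
  have ht : 1 ≤ t := by
    by_contra h
    rw [Nat.lt_one_iff.1 (not_le.1 h)] at hnt
    omega
  obtain ⟨hB, hc⟩ := log_bounds ha r hn had (by omega) hd ht htr
  have hk : Fintype.card (Fin ((n + d).choose d) × Fin t) = (n + d).choose d * t := by simp
  have hMpos : 0 < (n + d).choose d := Nat.choose_pos (by omega)
  have hN : Fintype.card (Line K n × (Fin (d + 1) → Fin t → ZMod 2)) =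
      Fintype.card (Line K n) * (2 ^ t) ^ (d + 1) := by simp
  have hle := Line.card_le K n
  have hge := Line.le_card K n (by omega)
  rw [hK] at hle hge
  have hQn : (100 : ℝ) ≤ Fintype.card K := by
    rw [hK]
    exact_mod_cast hn.trans hnt
  have hdK : (d : ℝ) / Fintype.card K ≤ 1 / 100 := by
    rw [div_le_div_iff₀ (by linarith) (by norm_num), hK]
    have : (100 * d : ℕ) ≤ 2 ^ t := hdn.trans hnt
    have h' : ((100 * d : ℕ) : ℝ) ≤ (2 ^ t : ℕ) := Nat.cast_le.2 this
    push_cast at h' ⊢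
    linarith
  have hK1 : 1 / (Fintype.card K : ℝ) ≤ 1 / 100 := one_div_le_one_div_of_le (by norm_num) hQn
  have hlinepos : 0 < Fintype.card (Line K n) := lt_of_lt_of_le (by positivity) hge
  have hNpos : (0 : ℝ) < Fintype.card (Line K n × (Fin (d + 1) → Fin t → ZMod 2)) := by
    rw [hN]
    positivity
  refine ⟨P.injective_code, ?_, P.isRLDC_code hdK hK1, ?_, P.isRLCC_code hdK hK1 (by norm_num),
    fun q hq η hη => ?_⟩
  · rw [hk]
    refine le_rpow_of_log_le hNpos (by exact_mod_cast Nat.mul_pos hMpos ht) (le_trans ?_ hB)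
    have h1 : Fintype.card (Line K n × (Fin (d + 1) → Fin t → ZMod 2)) ≤ 2 ^ (4 * n * t) := by
      rw [hN]
      calc _ ≤ (2 ^ t) ^ (2 * n) * (2 ^ t) ^ (d + 1) := Nat.mul_le_mul_right _ hle
        _ = 2 ^ (t * (2 * n + (d + 1))) := by rw [← pow_add, ← pow_mul]
        _ ≤ _ := Nat.pow_le_pow_right (by norm_num) (by nlinarith)
    have h2 := Real.log_le_log hNpos (Nat.cast_le.2 h1)
    refine h2.trans_eq ?_
    push_cast
    rw [Real.log_pow]
    push_cast
    ring
  · rw [show (1 / 2 - 1 / 6 : ℝ) = 1 / 3 by norm_num]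
    exact P.isRLCC_code hdK hK1 (by norm_num)
  · rw [hk] at hq
    have hqd : q ≤ d := by exact_mod_cast hq.trans hc
    refine P.not_isLDC_code (⟨0, hMpos⟩, ⟨0, ht⟩) hqd ?_ hη
    refine le_rpow_mul_of_cube_le hNpos le_rfl ?_
    rw [hN, hK]
    have h1 : ((2 ^ t) ^ n * (2 ^ t) ^ (d + 1)) ^ 3 ≤
        (Fintype.card (Line K n) * (2 ^ t) ^ (d + 1)) ^ 2 := by
      -- The comparison of exponents amounts to `d + 7 ≤ n`, which follows from `100 d ≤ n` and `n ≥
      -- 100`.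
      calc ((2 ^ t) ^ n * (2 ^ t) ^ (d + 1)) ^ 3 = (2 ^ t) ^ (3 * (n + (d + 1))) := by
            rw [← pow_add, ← pow_mul, mul_comm (n + (d + 1))]
        _ ≤ (2 ^ t) ^ (2 * (2 * n - 3 + (d + 1))) :=
            Nat.pow_le_pow_right (by positivity) (by omega)
        _ = ((2 ^ t) ^ (2 * n - 3) * (2 ^ t) ^ (d + 1)) ^ 2 := by
            rw [← pow_add, mul_comm 2 (2 * n - 3 + (d + 1)), pow_mul]
        _ ≤ _ := Nat.pow_le_pow_left (Nat.mul_le_mul_right _ hge) 2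
    exact_mod_cast h1

theorem exists_isSeparatingCode {a : ℝ} (ha : 0 < a) (r : ℕ) {n d t : ℕ} (hn : 1 ≤ n)
    (had : a * n ≤ d) (hdn : (d : ℝ) ≤ 1 / 100 * n) (hnt : n ≤ 2 ^ t) (htr : 2 ^ t ≤ n ^ r) :
    Nonempty (LineHadamardData (GaloisField 2 t) n d t) ∧
      ∀ P : LineHadamardData (GaloisField 2 t) n d t,
        IsSeparatingCode P.code (1 / 1000) (1 / 6)
          (4 * (r + 1) * (1 + |Real.log (a * Real.log 2)|) / (a * Real.log 2)) (a / (r + 2)) 1 := by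
  have hn' : (1 : ℝ) ≤ n := by exact_mod_cast hn
  have hd : 1 ≤ d := by
    have : (0 : ℝ) < d := lt_of_lt_of_le (by positivity) had
    exact_mod_cast this
  have hdn' : 100 * d ≤ n := by
    have : (100 * d : ℝ) ≤ n := by linarith
    exact_mod_cast this
  have ht : t ≠ 0 := by
    rintro rfl
    omega
  have : Fintype (GaloisField 2 t) := Fintype.ofFinite _
  have hK : Fintype.card (GaloisField 2 t) = 2 ^ t := by
    rw [← Nat.card_eq_fintype_card, GaloisField.card 2 t ht]
  exact ⟨nonempty_of_card hK (by omega), fun P =>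
    P.isSeparatingCode hK ha r (by omega) hd had hdn' hnt htr⟩

end LineHadamardData

/-! ### Simulation of decoders and monotonicity in the constants. -/

namespace DecisionTree

variable {ι ι' α β : Type}

/-- Replace every position by a position of another string or by a constant symbol. -/
def subst (f : ι → ι' ⊕ α) : DecisionTree ι α β → DecisionTree ι' α β
  | leaf out => leaf out
  | query j next =>
    match f j with
    | Sum.inl i => query i fun s => (next s).subst f
    | Sum.inr s => (next s).subst f

theorem eval_subst (f : ι → ι' ⊕ α) (y : ι' → α) (T : DecisionTree ι α β) :
    (T.subst f).eval y = T.eval fun j => Sum.elim y id (f j) := by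
  induction T with
  | leaf out => rfl
  | query j next ih =>
    cases h : f j <;> simp [subst, eval, h, ih]

theorem numQueries_subst_le (f : ι → ι' ⊕ α) (y : ι' → α) (T : DecisionTree ι α β) :
    (T.subst f).numQueries y ≤ T.numQueries fun j => Sum.elim y id (f j) := by
  induction T with
  | leaf out => exact le_rfl
  | query j next ih =>
    cases h : f j with
    | inl i => simpa [subst, numQueries, h] using ih (y i)
    | inr s => simpa [subst, numQueries, h] using (ih s).trans (Nat.le_succ _)

end DecisionTree

namespace LocalAlgorithm

variable {κ κ' ι ι' α β : Type}

/-- On input `i`, simulate the algorithm on input `r i` and on the string described by `f i`. -/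
noncomputable def simulate (Dec : LocalAlgorithm κ ι α β) (r : κ' → κ) (f : κ' → ι → ι' ⊕ α) :
    LocalAlgorithm κ' ι' α β :=
  fun i => (Dec (r i)).map (DecisionTree.subst (f i))

theorem QueriesAtMost.simulate {Dec : LocalAlgorithm κ ι α β} {q : ℕ} (h : Dec.QueriesAtMost q)
    (r : κ' → κ) (f : κ' → ι → ι' ⊕ α) : (Dec.simulate r f).QueriesAtMost q := by
  intro i T hT y
  simp only [LocalAlgorithm.simulate, PMF.support_map, Set.mem_image] at hT
  obtain ⟨T', hT', rfl⟩ := hT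
  exact (DecisionTree.numQueries_subst_le _ _ _).trans (h _ T' hT' _)

theorem prob_simulate (Dec : LocalAlgorithm κ ι α β) (r : κ' → κ) (f : κ' → ι → ι' ⊕ α)
    (y : ι' → α) (i : κ') (E : Set β) :
    (Dec.simulate r f).prob y i E = Dec.prob (fun j => Sum.elim y id (f i j)) (r i) E := by
  change (((Dec (r i)).map (DecisionTree.subst (f i))).toOuterMeasure _).toReal = _
  rw [PMF.toOuterMeasure_map_apply]
  refine congrArg (fun s => ((Dec (r i)).toOuterMeasure s).toReal) (Set.ext fun T => ?_)
  simp only [Set.mem_preimage, Set.mem_ofPred_eq, DecisionTree.eval_subst]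

end LocalAlgorithm

section Monotone

variable {κ ι : Type} [Fintype ι]

theorem IsRLDC.mono {C : (κ → ZMod 2) → (ι → ZMod 2)} {q : ℕ} {δ δ' c s : ℝ} (h : IsRLDC C q δ c s)
    (hδ : δ' ≤ δ) : IsRLDC C q δ' c s := by
  obtain ⟨Dec, h1, h2, h3⟩ := h
  exact ⟨Dec, h1, h2, fun b i y hy => h3 b i y
    (hy.trans (mul_le_mul_of_nonneg_right hδ (Nat.cast_nonneg _)))⟩

theorem IsRLCC.mono {C : (κ → ZMod 2) → (ι → ZMod 2)} {q : ℕ} {δ δ' c s : ℝ} (h : IsRLCC C q δ c s)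
    (hδ : δ' ≤ δ) : IsRLCC C q δ' c s := by
  obtain ⟨Dec, h1, h2, h3⟩ := h
  exact ⟨Dec, h1, h2, fun b i y hy => h3 b i y
    (hy.trans (mul_le_mul_of_nonneg_right hδ (Nat.cast_nonneg _)))⟩

/-- Because `e < 3`, the exponent in the blocklength bound is positive from `k = 3` on, and
enlarging `B` weakens the bound. -/
theorem loglog_three_pos : 0 < Real.log (Real.log 3) := by
  refine Real.log_pos ?_
  rw [Real.lt_log_iff_exp_lt (by norm_num)]
  linarith [Real.exp_one_lt_d9]

theorem one_le_log_of_three_le {k : ℝ} (hk : 3 ≤ k) : 1 ≤ Real.log k := by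
  rw [Real.le_log_iff_exp_le (by linarith)]
  linarith [Real.exp_one_lt_d9]

theorem loglog_three_le {k : ℝ} (hk : 3 ≤ k) :
    Real.log (Real.log 3) ≤ Real.log (Real.log k) := by
  have h3 : 1 ≤ Real.log 3 := one_le_log_of_three_le le_rfl
  exact Real.log_le_log (by linarith) (Real.log_le_log (by norm_num) hk)

theorem IsSeparatingCode.mono [Fintype κ] {C : (κ → ZMod 2) →ₗ[ZMod 2] (ι → ZMod 2)}
    {δ δ' ε B B' c c' D : ℝ} (h : IsSeparatingCode C δ ε B c D) (hk : 3 ≤ Fintype.card κ)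
    (hδ : δ' ≤ δ) (hB : B ≤ B') (hc : c' ≤ c) : IsSeparatingCode C δ' ε B' c' D := by
  have hk' : (3 : ℝ) ≤ Fintype.card κ := by exact_mod_cast hk
  refine ⟨h.injective, h.blocklength_le.trans ?_, h.isRLDC.mono hδ, h.isRLCC.mono hδ,
    h.isRLCC'.mono hδ, fun q hq => h.not_isLDC q (hq.trans ?_)⟩
  · refine Real.rpow_le_rpow_of_exponent_le (by linarith) ?_
    exact mul_le_mul_of_nonneg_right hB (loglog_three_pos.le.trans (loglog_three_le hk'))
  · exact mul_le_mul_of_nonneg_right hc (by linarith [one_le_log_of_three_le hk'])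

end Monotone

/-- The identity code is separating if the decoding radius is less than one position and no query is
allowed to a locally decodable code. -/
theorem isSeparatingCode_id {k : ℕ} (hk : 3 ≤ k) {δ ε B c D : ℝ} (hδ : δ * k < 1)
    (hε : ε ≤ 1 / 2) (hB : 1 / Real.log (Real.log 3) ≤ B) (hc : c * Real.log k < 1) (hD : 0 < D) :
    IsSeparatingCode (LinearMap.id : (Fin k → ZMod 2) →ₗ[ZMod 2] _) δ ε B c D := by
  classical
  have hk' : (3 : ℝ) ≤ k := by exact_mod_cast hk
  have hdec : ∀ {q : ℕ} {s : ℝ}, 1 ≤ q → 0 ≤ s →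
      ∃ Dec : LocalAlgorithm (Fin k) (Fin k) (ZMod 2) (Option (ZMod 2)),
        Dec.QueriesAtMost q ∧
        (∀ (b : Fin k → ZMod 2) i, 1 ≤ Dec.prob b i {some (b i)}) ∧
        (∀ (b : Fin k → ZMod 2) i (y : Fin k → ZMod 2),
          (hammingDist y b : ℝ) ≤ δ * Fintype.card (Fin k) →
          Dec.prob y i {some (b i), none}ᶜ ≤ s) := by
    intro q s hq hs
    refine exists_relaxedDecoder (Ω := Unit) (fun b : Fin k → ZMod 2 => b) (fun i b => b i)
      (fun i _ => [i]) (fun _ _ => []) (fun _ _ => by simpa using hq) (by simp) (by simp) ?_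
    intro e he i
    have he0 : e = 0 := by
      rw [Fintype.card_fin] at he
      have : (hammingNorm e : ℝ) < 1 := he.trans_lt hδ
      exact hammingNorm_eq_zero.1 (Nat.lt_one_iff.1 (by exact_mod_cast this))
    refine le_of_eq_of_le (Finset.expect_eq_zero fun ω _ => fooledInd_of_not fun h => h.2 ?_) hs
    simp [he0]
  refine ⟨fun _ _ h => h, ?_, hdec (by norm_num) (by norm_num), hdec (by norm_num) (by linarith),
    hdec (by norm_num) (by norm_num), fun q hq η hη => ?_⟩
  · rw [Fintype.card_fin]
    have h1 : 1 ≤ B * Real.log (Real.log k) := by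
      rw [div_le_iff₀ loglog_three_pos] at hB
      refine hB.trans (mul_le_mul_of_nonneg_left (loglog_three_le hk') ?_)
      by_contra h
      nlinarith [loglog_three_pos]
    calc (k : ℝ) = (k : ℝ) ^ (1 : ℝ) := (Real.rpow_one _).symm
      _ ≤ _ := Real.rpow_le_rpow_of_exponent_le (by linarith) h1
  · rw [Fintype.card_fin] at hq
    have hq0 : q = 0 := by
      have : (q : ℝ) < 1 := hq.trans_lt hc
      exact Nat.lt_one_iff.1 (by exact_mod_cast this)
    subst hq0
    refine not_isLDC_of_shift _ ⟨0, by omega⟩ ∅ (fun l hl => ⟨1, rfl, fun j hj => ?_⟩) ?_ hη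
    · rw [List.length_eq_zero_iff.1 (Nat.le_zero.1 hl)] at hj
      simp at hj
    · simp only [Finset.card_empty, Nat.cast_zero]
      positivity

/-! ### Extending message lengths by copies. -/

section Copies

variable {κ κ₀ ι ι₀ : Type} {S : ℕ}

/-- `S` copies of a code, of which the one with index `s` encodes the message bits `i` with
`(g i).1 = s`. -/
noncomputable def copiesCode (C₀ : (κ₀ → ZMod 2) →ₗ[ZMod 2] (ι₀ → ZMod 2)) (g : κ → Fin S × κ₀)
    (φ : ι ≃ Fin S × ι₀) : (κ → ZMod 2) →ₗ[ZMod 2] (ι → ZMod 2) :=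
  LinearMap.pi fun u => LinearMap.proj (φ u).2 ∘ₗ C₀ ∘ₗ
    LinearMap.funLeft (ZMod 2) (ZMod 2) (fun j => ((φ u).1, j)) ∘ₗ
      Function.ExtendByZero.linearMap (ZMod 2) g

theorem copiesCode_apply (C₀ : (κ₀ → ZMod 2) →ₗ[ZMod 2] (ι₀ → ZMod 2)) (g : κ → Fin S × κ₀)
    (φ : ι ≃ Fin S × ι₀) (b : κ → ZMod 2) (u : ι) :
    copiesCode C₀ g φ b u = C₀ (fun j => Function.extend g b 0 ((φ u).1, j)) (φ u).2 := rfl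

variable [Fintype ι] [Fintype ι₀]

theorem hammingDist_comp_le {y z : ι → ZMod 2} {f : ι₀ → ι} (hf : Function.Injective f) :
    hammingDist (fun j => y (f j)) (fun j => z (f j)) ≤ hammingDist y z := by
  classical
  refine Finset.card_le_card_of_injOn f (fun j hj => ?_) hf.injOn
  simpa using hj

/-- Run the decoder inside the relevant copy. All errors might fall into that copy, which has a
`1/S` share of the positions; hence the radius `δ / S`. -/
theorem exists_copies_decoder (C₀ : (κ₀ → ZMod 2) →ₗ[ZMod 2] (ι₀ → ZMod 2)) (g : κ → Fin S × κ₀)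
    (φ : ι ≃ Fin S × ι₀) {κ₁ κ₁' : Type} (p : κ₁' → Fin S × κ₁) (target : κ₁ → (κ₀ → ZMod 2) → ZMod 2)
    {q : ℕ} {δ c s : ℝ} (hS : 0 < S)
    (h : ∃ Dec : LocalAlgorithm κ₁ ι₀ (ZMod 2) (Option (ZMod 2)),
      Dec.QueriesAtMost q ∧
      (∀ b i, c ≤ Dec.prob (C₀ b) i {some (target i b)}) ∧
      (∀ b i (y : ι₀ → ZMod 2), (hammingDist y (C₀ b) : ℝ) ≤ δ * Fintype.card ι₀ →
        Dec.prob y i {some (target i b), none}ᶜ ≤ s)) :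
    ∃ Dec : LocalAlgorithm κ₁' ι (ZMod 2) (Option (ZMod 2)),
      Dec.QueriesAtMost q ∧
      (∀ b i, c ≤ Dec.prob (copiesCode C₀ g φ b) i
        {some (target (p i).2 fun j => Function.extend g b 0 ((p i).1, j))}) ∧
      (∀ b i (y : ι → ZMod 2),
        (hammingDist y (copiesCode C₀ g φ b) : ℝ) ≤ δ / S * Fintype.card ι →
        Dec.prob y i
          {some (target (p i).2 fun j => Function.extend g b 0 ((p i).1, j)), none}ᶜ ≤ s) := by
  obtain ⟨Dec, h1, h2, h3⟩ := h
  have hblock : ∀ b s, (fun j : ι₀ => copiesCode C₀ g φ b (φ.symm (s, j))) =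
      C₀ fun j => Function.extend g b 0 (s, j) := fun b s => by
    funext j
    rw [copiesCode_apply, Equiv.apply_symm_apply]
  refine ⟨Dec.simulate (fun i => (p i).2) fun i j => Sum.inl (φ.symm ((p i).1, j)),
    h1.simulate _ _, fun b i => ?_, fun b i y hy => ?_⟩
  · rw [LocalAlgorithm.prob_simulate]
    simp only [Sum.elim_inl, hblock]
    exact h2 _ _
  · rw [LocalAlgorithm.prob_simulate]
    simp only [Sum.elim_inl]
    refine h3 _ _ _ ?_
    rw [← hblock]
    have hinj : Function.Injective fun j : ι₀ => φ.symm ((p i).1, j) := fun j j' hj =>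
      (Prod.ext_iff.1 (φ.symm.injective hj)).2
    refine (Nat.cast_le.2 (hammingDist_comp_le hinj)).trans (hy.trans_eq ?_)
    have hS' : (S : ℝ) ≠ 0 := by exact_mod_cast hS.ne'
    rw [Fintype.card_congr φ, Fintype.card_prod, Fintype.card_fin, Nat.cast_mul]
    field_simp

/-- Copy `0` is full by the choice of `e`. Put the message there and zeros elsewhere: the other
copies are then all zero and can be simulated without queries or errors. -/
theorem IsLDC.of_copies [NeZero S] {C₀ : (κ₀ → ZMod 2) →ₗ[ZMod 2] (ι₀ → ZMod 2)}
    {g : κ → Fin S × κ₀} (hg : Function.Injective g) {φ : ι ≃ Fin S × ι₀} {e : κ₀ → κ}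
    (he : ∀ j, g (e j) = (0, j)) {q : ℕ} {ρ ρ₀ c s : ℝ}
    (hρ : ρ₀ * Fintype.card ι₀ ≤ ρ * Fintype.card ι) (h : IsLDC (copiesCode C₀ g φ) q ρ c s) :
    IsLDC C₀ q ρ₀ c s := by
  classical
  obtain ⟨Dec, h1, h2, h3⟩ := h
  have heinj : Function.Injective e := fun j j' hj => by
    have := he j
    rw [hj, he j'] at this
    exact (Prod.ext_iff.1 this).2.symm
  let f : ι → ι₀ ⊕ ZMod 2 := fun u => if (φ u).1 = 0 then Sum.inl (φ u).2 else Sum.inr 0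
  have hf : ∀ (y : ι₀ → ZMod 2) u, Sum.elim y id (f u) = if (φ u).1 = 0 then y (φ u).2 else 0 := by
    intro y u
    by_cases hu : (φ u).1 = 0 <;> simp [f, hu]
  have hb : ∀ b₀ : κ₀ → ZMod 2, copiesCode C₀ g φ (Function.extend e b₀ 0) =
      fun u => Sum.elim (C₀ b₀) id (f u) := by
    intro b₀
    funext u
    rw [hf, copiesCode_apply]
    split_ifs with hu
    · rw [show (fun j => Function.extend g (Function.extend e b₀ 0) 0 ((φ u).1, j)) = b₀ from
        funext fun j => by rw [hu, ← he j, hg.extend_apply, heinj.extend_apply]]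
    · rw [show (fun j => Function.extend g (Function.extend e b₀ 0) 0 ((φ u).1, j)) = 0 from ?_,
        map_zero, Pi.zero_apply]
      funext j
      by_cases hj : ∃ i, g i = ((φ u).1, j)
      · obtain ⟨i, hi⟩ := hj
        rw [← hi, hg.extend_apply, Function.extend_apply', Pi.zero_apply, Pi.zero_apply]
        rintro ⟨j', rfl⟩
        rw [he] at hi
        exact hu (Prod.ext_iff.1 hi).1.symm
      · rw [Function.extend_apply' _ _ _ hj, Pi.zero_apply, Pi.zero_apply]
  refine ⟨Dec.simulate e fun _ => f, h1.simulate _ _, fun b₀ j => ?_, fun b₀ j y hy => ?_⟩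
  · rw [LocalAlgorithm.prob_simulate, ← hb, ← heinj.extend_apply b₀ 0 j]
    exact h2 _ _
  · rw [LocalAlgorithm.prob_simulate, ← heinj.extend_apply b₀ 0 j]
    refine h3 _ _ _ (le_trans (Nat.cast_le.2 ?_) (hy.trans hρ))
    rw [hb]
    refine Finset.card_le_card_of_injOn (fun u => (φ u).2) (fun u hu => ?_) fun u hu u' hu' huu' => ?_
    all_goals
      simp only [hf, ne_eq, Finset.coe_filter, Finset.mem_univ, true_and, Set.mem_ofPred_eq] at *
    · by_cases h0 : (φ u).1 = 0
      · simpa [h0] using hu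
      · simp [h0] at hu
    · have h0 : ∀ u, ¬ ((if (φ u).1 = 0 then y (φ u).2 else 0) =
          if (φ u).1 = 0 then C₀ b₀ (φ u).2 else 0) → (φ u).1 = 0 := fun u hu => by
        by_contra h0
        simp [h0] at hu
      exact φ.injective (Prod.ext ((h0 u hu).trans (h0 u' hu').symm) huu')

theorem IsSeparatingCode.copies [NeZero S] [Fintype κ] [Fintype κ₀]
    {C₀ : (κ₀ → ZMod 2) →ₗ[ZMod 2] (ι₀ → ZMod 2)} {δ ε B c D : ℝ}
    (h : IsSeparatingCode C₀ δ ε B c D) (hB : 0 ≤ B) (hc : 0 ≤ c) (hD : 0 ≤ D)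
    {g : κ → Fin S × κ₀} (hg : Function.Injective g) (φ : ι ≃ Fin S × ι₀) {e : κ₀ → κ}
    (he : ∀ j, g (e j) = (0, j)) (hκ₀ : 3 ≤ Fintype.card κ₀) :
    IsSeparatingCode (copiesCode C₀ g φ) (δ / S) ε
      (B + Real.log S / (Real.log 3 * Real.log (Real.log 3))) (c / (1 + Real.log S)) D := by
  have hSpos : 0 < S := Nat.pos_of_ne_zero (NeZero.ne S)
  have hS1 : (1 : ℝ) ≤ S := by exact_mod_cast hSpos
  have hlogS : 0 ≤ Real.log S := Real.log_nonneg hS1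
  have heinj : Function.Injective e := fun j j' hj => by
    have := he j
    rw [hj, he j'] at this
    exact (Prod.ext_iff.1 this).2.symm
  have hcard : Fintype.card κ₀ ≤ Fintype.card κ := Fintype.card_le_of_injective e heinj
  have hcard' : Fintype.card κ ≤ S * Fintype.card κ₀ := by
    have := Fintype.card_le_of_injective g hg
    rwa [Fintype.card_prod, Fintype.card_fin] at this
  have hk₀ : (3 : ℝ) ≤ Fintype.card κ₀ := by exact_mod_cast hκ₀
  have hk : (Fintype.card κ₀ : ℝ) ≤ Fintype.card κ := by exact_mod_cast hcard
  have hk' : (Fintype.card κ : ℝ) ≤ S * Fintype.card κ₀ := by exact_mod_cast hcard'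
  have hN : (Fintype.card ι : ℝ) = S * Fintype.card ι₀ := by
    rw [Fintype.card_congr φ, Fintype.card_prod, Fintype.card_fin, Nat.cast_mul]
  have hext : ∀ (b : κ → ZMod 2) i, Function.extend g b 0 ((g i).1, (g i).2) = b i :=
    fun b i => hg.extend_apply b 0 i
  have hrlcc : ∀ {q : ℕ} {s : ℝ}, IsRLCC C₀ q δ 1 s → IsRLCC (copiesCode C₀ g φ) q (δ / S) 1 s :=
    fun hC => exists_copies_decoder C₀ g φ (fun u => φ u) (fun u b => C₀ b u) hSpos hC
  refine ⟨fun b b' hbb' => ?_, ?_, ?_, hrlcc h.isRLCC, hrlcc h.isRLCC', fun q hq η hη hC => ?_⟩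
  · funext i
    have h1 : C₀ (fun j => Function.extend g b 0 ((g i).1, j)) =
        C₀ fun j => Function.extend g b' 0 ((g i).1, j) := by
      funext u
      have := congrFun hbb' (φ.symm ((g i).1, u))
      rwa [copiesCode_apply, copiesCode_apply, Equiv.apply_symm_apply] at this
    have h2 := congrFun (h.injective h1) (g i).2
    rwa [hext, hext] at h2
  · have hll := loglog_three_pos
    have hl3 : 0 < Real.log 3 := Real.log_pos (by norm_num)
    have hllk := loglog_three_le (hk₀.trans hk)
    rw [hN, add_mul, Real.rpow_add (by linarith), mul_comm]
    refine mul_le_mul (h.blocklength_le.trans ?_) ?_ (by positivity) (by positivity)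
    · refine (Real.rpow_le_rpow (by positivity) hk ?_).trans
        (Real.rpow_le_rpow_of_exponent_le (by linarith) ?_)
      · exact mul_nonneg hB (hll.le.trans (loglog_three_le hk₀))
      · refine mul_le_mul_of_nonneg_left (Real.log_le_log ?_ (Real.log_le_log (by linarith) hk)) hB
        linarith [one_le_log_of_three_le hk₀]
    -- The extra exponent is chosen so that its power equals `S` at `k = 3`, the smallest case.
    · refine (Real.le_rpow_iff_log_le (by linarith) (by linarith)).2 ?_
      calc Real.log S = Real.log S / (Real.log 3 * Real.log (Real.log 3)) *
            Real.log (Real.log 3) * Real.log 3 := by field_simp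
        _ ≤ _ := by
          have h3 : Real.log 3 ≤ Real.log (Fintype.card κ) :=
            Real.log_le_log (by norm_num) (hk₀.trans hk)
          have h4 : 0 ≤ Real.log (Real.log (Fintype.card κ)) := hll.le.trans hllk
          gcongr
  · have := exists_copies_decoder C₀ g φ g (fun j b => b j) hSpos h.isRLDC
    simp only [hext] at this
    exact this
  · refine h.not_isLDC q (hq.trans ?_) η hη (IsLDC.of_copies hg he ?_ hC)
    -- `log k ≤ log S + log k₀ ≤ (1 + log S) log k₀`, because `log k₀ ≥ 1`.
    · rw [div_mul_eq_mul_div, div_le_iff₀ (by linarith), mul_assoc]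
      refine mul_le_mul_of_nonneg_left ?_ hc
      have h1 := Real.log_le_log (by linarith) hk'
      rw [Real.log_mul (by linarith) (by linarith)] at h1
      nlinarith [one_le_log_of_three_le hk₀]
    · rw [hN, Real.mul_rpow (by linarith) (Nat.cast_nonneg _)]
      have h1 : (1 : ℝ) ≤ (S : ℝ) ^ (-(1 / 3) : ℝ) * S := by
        nth_rewrite 2 [← Real.rpow_one (S : ℝ)]
        rw [← Real.rpow_add (by linarith)]
        exact Real.one_le_rpow hS1 (by norm_num)
      calc D * (Fintype.card ι₀ : ℝ) ^ (-(1 / 3) : ℝ) * Fintype.card ι₀ =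
          1 * (D * (Fintype.card ι₀ : ℝ) ^ (-(1 / 3) : ℝ) * Fintype.card ι₀) := (one_mul _).symm
        _ ≤ ((S : ℝ) ^ (-(1 / 3) : ℝ) * S) *
            (D * (Fintype.card ι₀ : ℝ) ^ (-(1 / 3) : ℝ) * Fintype.card ι₀) :=
          mul_le_mul_of_nonneg_right h1 (by positivity)
        _ = _ := by ring

theorem IsSeparatingCode.exists_of_le_mul [NeZero S] [Fintype κ₀]
    {C₀ : (κ₀ → ZMod 2) →ₗ[ZMod 2] (ι₀ → ZMod 2)} {δ ε B c D : ℝ}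
    (h : IsSeparatingCode C₀ δ ε B c D) (hB : 0 ≤ B) (hc : 0 ≤ c) (hD : 0 ≤ D)
    (hκ₀ : 3 ≤ Fintype.card κ₀) {k : ℕ} (hk : Fintype.card κ₀ ≤ k)
    (hk' : k ≤ S * Fintype.card κ₀) :
    ∃ (N : ℕ) (C : (Fin k → ZMod 2) →ₗ[ZMod 2] (Fin N → ZMod 2)), IsSeparatingCode C (δ / S) ε
      (B + Real.log S / (Real.log 3 * Real.log (Real.log 3))) (c / (1 + Real.log S)) D := by
  let ψ := Fintype.equivFin κ₀
  have hmpos : 0 < Fintype.card κ₀ := by omega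
  let g : Fin k → Fin S × κ₀ := fun i =>
    (⟨i / Fintype.card κ₀, Nat.div_lt_of_lt_mul (by
      rw [mul_comm]
      exact i.2.trans_le hk')⟩, ψ.symm ⟨i % Fintype.card κ₀, Nat.mod_lt _ hmpos⟩)
  have hg : Function.Injective g := by
    intro i i' hii'
    have h1 : (i : ℕ) / Fintype.card κ₀ = i' / Fintype.card κ₀ :=
      Fin.mk.inj_iff.1 (Prod.ext_iff.1 hii').1
    have h2 : (i : ℕ) % Fintype.card κ₀ = i' % Fintype.card κ₀ :=
      Fin.mk.inj_iff.1 (ψ.symm.injective (Prod.ext_iff.1 hii').2)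
    rw [Fin.ext_iff, ← Nat.div_add_mod i (Fintype.card κ₀), h1, h2, Nat.div_add_mod]
  refine ⟨_, _, h.copies hB hc hD hg (Fintype.equivFin (Fin S × ι₀)).symm
    (e := fun j => Fin.castLE hk (ψ j)) (fun j => ?_) hκ₀⟩
  refine Prod.ext (Fin.ext ?_) ?_
  · simp [g, Nat.div_eq_of_lt (ψ j).2]
  · simp [g, Nat.mod_eq_of_lt (ψ j).2]

end Copies

/-! ### Density of the message lengths and the code for every `k`. -/

section MessageLengths

theorem choose_succ_le_two_mul {N k : ℕ} (h : 2 * k ≤ N + 1) : (N + 1).choose k ≤ 2 * N.choose k := by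
  have h1 := Nat.choose_mul_succ_eq N k
  refine Nat.le_of_mul_le_mul_right (c := N + 1 - k) ?_ (by omega)
  rw [← h1]
  calc N.choose k * (N + 1) ≤ N.choose k * (2 * (N + 1 - k)) := Nat.mul_le_mul_left _ (by omega)
    _ = _ := by ring

theorem choose_add_le_two_pow_mul {N k : ℕ} (h : 2 * k ≤ N + 1) (j : ℕ) :
    (N + j).choose k ≤ 2 ^ j * N.choose k := by
  induction j with
  | zero => simp
  | succ j ih =>
    rw [← add_assoc, pow_succ, mul_comm (2 ^ j), mul_assoc]
    exact (choose_succ_le_two_mul (by omega)).trans (Nat.mul_le_mul_left _ ih)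

/-- The message lengths of the codes with `n = 100 * d` and the smallest possible `t`. -/
def messageLength (d : ℕ) : ℕ := (100 * d + d).choose d * Nat.clog 2 (100 * d)

theorem exists_messageLength_succ_le :
    ∃ S, 0 < S ∧ ∀ d, 1 ≤ d → messageLength (d + 1) ≤ S * messageLength d := by
  -- Raising both binomial entries by one costs a factor at most `101`, each of the 100 further
  -- steps of the upper entry at most `2`, and the growth of `t` at most `2`.
  refine ⟨2 ^ 100 * 101 * 2, by positivity, fun d hd => ?_⟩
  have h1 : (100 * (d + 1) + (d + 1)).choose (d + 1) ≤ 2 ^ 100 * 101 * (100 * d + d).choose d := by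
    rw [show 100 * (d + 1) + (d + 1) = (100 * d + d + 1) + 100 by ring, mul_assoc]
    refine (choose_add_le_two_pow_mul (by omega) 100).trans (Nat.mul_le_mul_left _ ?_)
    refine Nat.le_of_mul_le_mul_right (c := d + 1) ?_ (Nat.succ_pos d)
    rw [← Nat.add_one_mul_choose_eq]
    calc (100 * d + d + 1) * (100 * d + d).choose d ≤ (101 * (d + 1)) * (100 * d + d).choose d :=
          Nat.mul_le_mul_right _ (by omega)
      _ = _ := by ring
  have h2 : Nat.clog 2 (100 * (d + 1)) ≤ 2 * Nat.clog 2 (100 * d) := by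
    have h3 : 1 ≤ Nat.clog 2 (100 * d) := Nat.clog_pos (by norm_num) (by omega)
    have h4 : 100 * d ≤ 2 ^ Nat.clog 2 (100 * d) := Nat.le_pow_clog (by norm_num) _
    have h5 : Nat.clog 2 (100 * (d + 1)) ≤ Nat.clog 2 (100 * d) + 1 := by
      refine Nat.clog_le_of_le_pow ?_
      rw [pow_succ]
      omega
    omega
  calc messageLength (d + 1) ≤ (2 ^ 100 * 101 * (100 * d + d).choose d) *
        (2 * Nat.clog 2 (100 * d)) := Nat.mul_le_mul h1 h2
    _ = _ := by
      unfold messageLength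
      ring

theorem lt_messageLength {d : ℕ} (hd : 1 ≤ d) : d < messageLength d := by
  have h1 : 100 * d + 1 ≤ (100 * d + d).choose d := succ_le_choose hd
  have h2 : 1 ≤ Nat.clog 2 (100 * d) := Nat.clog_pos (by norm_num) (by omega)
  unfold messageLength
  nlinarith

theorem exists_messageLength_le {k : ℕ} (hk : messageLength 1 ≤ k) :
    ∃ d, 1 ≤ d ∧ messageLength d ≤ k ∧ k < messageLength (d + 1) := by
  classical
  have hex : ∃ d, k < messageLength (d + 1) := ⟨k, by
    have := lt_messageLength (d := k + 1) (by omega)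
    omega⟩
  have hd := Nat.find_spec hex
  have hmin := fun m => Nat.find_min hex (m := m)
  generalize Nat.find hex = d at hd hmin
  rcases Nat.eq_zero_or_pos d with rfl | hpos
  · exact absurd hd (not_lt.2 hk)
  · refine ⟨d, hpos, ?_, hd⟩
    have := hmin (d - 1) (by omega)
    rw [Nat.sub_add_cancel hpos] at this
    omega

end MessageLengths

theorem exists_isSeparatingCode_length :
    ∃ δ > (0 : ℝ), ∃ ε > (0 : ℝ), ∃ B > (0 : ℝ), ∃ c > (0 : ℝ), ∃ D > (0 : ℝ),
      ∀ k : ℕ, 3 ≤ k → ∃ (N : ℕ) (C : (Fin k → ZMod 2) →ₗ[ZMod 2] (Fin N → ZMod 2)),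
        IsSeparatingCode C δ ε B c D := by
  obtain ⟨S, hS, hSd⟩ := exists_messageLength_succ_le
  have : NeZero S := ⟨hS.ne'⟩
  have hS1 : (1 : ℝ) ≤ S := by exact_mod_cast hS
  have hlogS : 0 ≤ Real.log S := Real.log_nonneg hS1
  have hlog2 : 0 < Real.log 2 := Real.log_pos (by norm_num)
  have hlog3 : 0 < Real.log 3 := Real.log_pos (by norm_num)
  have hll := loglog_three_pos
  set B₀ : ℝ := 4 * ((2 : ℕ) + 1) * (1 + |Real.log (1 / 100 * Real.log 2)|) /
    (1 / 100 * Real.log 2) with hB₀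
  have hB₀pos : 0 < B₀ := by positivity
  set c₀ : ℝ := 1 / 100 / ((2 : ℕ) + 2) with hc₀
  have hc₀pos : 0 < c₀ := by positivity
  set M : ℝ := ((messageLength 1 : ℕ) : ℝ) with hM
  have hMpos : 0 ≤ M := Nat.cast_nonneg _
  have hlarge : ∀ k : ℕ, messageLength 1 ≤ k →
      ∃ (N : ℕ) (C : (Fin k → ZMod 2) →ₗ[ZMod 2] (Fin N → ZMod 2)),
        IsSeparatingCode C (1 / 1000 / S) (1 / 6)
          (B₀ + Real.log S / (Real.log 3 * Real.log (Real.log 3))) (c₀ / (1 + Real.log S)) 1 := by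
    intro k hk
    obtain ⟨d, hd, hdk, hkd⟩ := exists_messageLength_le hk
    -- The least power of two above `n` is below `2 n ≤ n²`, so `r = 2` works.
    have hpow : 2 ^ Nat.clog 2 (100 * d) ≤ (100 * d) ^ 2 := by
      have h1 := Nat.pow_pred_clog_lt_self (b := 2) (by norm_num) (x := 100 * d) (by omega)
      have h2 : 1 ≤ Nat.clog 2 (100 * d) := Nat.clog_pos (by norm_num) (by omega)
      have h3 : 2 ^ Nat.clog 2 (100 * d) = 2 ^ (Nat.clog 2 (100 * d)).pred * 2 := by
        rw [← pow_succ, Nat.pred_eq_sub_one, Nat.sub_add_cancel h2]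
      rw [h3]
      nlinarith
    obtain ⟨⟨P⟩, hP⟩ := LineHadamardData.exists_isSeparatingCode (a := 1 / 100) (by norm_num) 2
      (n := 100 * d) (d := d) (t := Nat.clog 2 (100 * d)) (by omega) (by push_cast; linarith)
      (by push_cast; linarith) (Nat.le_pow_clog (by norm_num) _) hpow
    have hcard : Fintype.card (Fin ((100 * d + d).choose d) × Fin (Nat.clog 2 (100 * d))) =
        messageLength d := by
      simp [messageLength]
    refine (hP P).exists_of_le_mul hB₀pos.le hc₀pos.le zero_le_one ?_ (hcard.le.trans hdk) ?_
    · rw [hcard]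
      have h1 : 100 * d + 1 ≤ (100 * d + d).choose d := succ_le_choose hd
      have h2 : 1 ≤ Nat.clog 2 (100 * d) := Nat.clog_pos (by norm_num) (by omega)
      unfold messageLength
      nlinarith
    · rw [hcard]
      exact hkd.le.trans (hSd d hd)
  -- For `k < M` the value `1 / (M + 1)` leaves no room for an error or a query of a locally
  -- decodable code, as the identity code requires.
  refine ⟨min (1 / 1000 / S) (1 / (M + 1)), by positivity, 1 / 6, by norm_num,
    max (B₀ + Real.log S / (Real.log 3 * Real.log (Real.log 3))) (1 / Real.log (Real.log 3)),
    lt_max_of_lt_right (by positivity), min (c₀ / (1 + Real.log S)) (1 / (M + 1)), by positivity, 1,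
    one_pos, fun k hk => ?_⟩
  by_cases hkM : messageLength 1 ≤ k
  · obtain ⟨N, C, hC⟩ := hlarge k hkM
    exact ⟨N, C, hC.mono (by simpa using hk) (min_le_left _ _) (le_max_left _ _) (min_le_left _ _)⟩
  · have hk3 : (3 : ℝ) ≤ k := by exact_mod_cast hk
    have hkM' : (k : ℝ) < M + 1 := by
      have : (k : ℝ) < M := Nat.cast_lt.2 (not_le.1 hkM)
      linarith
    have hsmall : ∀ x : ℝ, 0 ≤ x → x ≤ k → ∀ z, min z (1 / (M + 1)) * x < 1 := by
      intro x hx hxk z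
      calc min z (1 / (M + 1)) * x ≤ 1 / (M + 1) * x :=
            mul_le_mul_of_nonneg_right (min_le_right _ _) hx
        _ < 1 := by
          rw [one_div_mul_eq_div, div_lt_one (by linarith)]
          linarith
    refine ⟨k, LinearMap.id, isSeparatingCode_id hk (hsmall k (by linarith) le_rfl _) (by norm_num)
      (le_max_right _ _) (hsmall _ ?_ ?_ _) one_pos⟩
    · linarith [one_le_log_of_three_le hk3]
    · exact (Real.log_le_sub_one_of_pos (by linarith)).trans (by linarith)

theorem mainTheorem3 :
    -- The construction, with `d = Θ(n)`, `d / n` a small constant, and `t = Θ(log n)`.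
    (∃ γ > (0 : ℝ), ∃ δ > (0 : ℝ), ∃ ε > (0 : ℝ),
      ∀ a > (0 : ℝ), ∀ r : ℕ, ∃ B > (0 : ℝ), ∃ c > (0 : ℝ), ∃ D > (0 : ℝ),
        ∀ n d t : ℕ, 1 ≤ n → a * n ≤ d → (d : ℝ) ≤ γ * n → n ≤ 2 ^ t → 2 ^ t ≤ n ^ r →
          Nonempty (LineHadamardData (GaloisField 2 t) n d t) ∧
          ∀ P : LineHadamardData (GaloisField 2 t) n d t,
            IsSeparatingCode P.code δ ε B c D) ∧
    -- A code for every message length `k`.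
    (∃ δ > (0 : ℝ), ∃ ε > (0 : ℝ), ∃ B > (0 : ℝ), ∃ c > (0 : ℝ), ∃ D > (0 : ℝ),
      ∀ k : ℕ, 3 ≤ k → ∃ (N : ℕ) (C : (Fin k → ZMod 2) →ₗ[ZMod 2] (Fin N → ZMod 2)),
        IsSeparatingCode C δ ε B c D) := by
  refine ⟨⟨1 / 100, by norm_num, 1 / 1000, by norm_num, 1 / 6, by norm_num, fun a ha r => ?_⟩,
    exists_isSeparatingCode_length⟩
  have hlog2 : 0 < Real.log 2 := Real.log_pos (by norm_num)
  exact ⟨_, by positivity, _, by positivity, 1, one_pos, fun n d t hn had hdn hnt htr =>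
    LineHadamardData.exists_isSeparatingCode ha r hn had hdn hnt htr⟩
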